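/- Let $\Sigma$ be a nonempty finite alphabet, $\Box\in\Sigma$ an arbitrary padding symbol, and $L\subseteq\Sigma^*$ a regular language. **Streaming algorithms.** A deterministic streaming algorithm over a finite alphabet $\Gamma$ is a deterministic automaton $P$ over $\Gamma$ with a nonempty, possibly infinite, set $M$ of memory states; it is an algorithm for the language it accepts. $P(u)$ denotes the state reached on input $u$. Its space is $s(P)=\log_2|M|\in[0,\infty]$. **Fixed-size model.** For $x=a_1\cdots a_m\in\Sigma^*$ and $n\in\mathbb N$ let $\mathrm{last}_n(x)=a_{m-n+1}\cdots a_m$ if $n\le m$ and $\mathrm{last}_n(x)=\Box^{\,n-m}a_1\cdots a_m$ if $n>m$. Let $\mathsf F_L(n)$ be the infimum of $s(P)$ over all streaming algorithms $P$ for $\{x\in\Sigma^*\mid \mathrm{last}_n(x)\in L\}$ (it is finite). **Variable-size model.** For $u\in(\Sigma\cup\{\downarrow\})^*$ define the window $\mathrm{wnd}(u)\in\Sigma^*$ by $\mathrm{wnd}(\varepsilon)=\varepsilon$, $\mathrm{wnd}(ua)=\mathrm{wnd}(u)a$ for $a\in\Sigma$, and let $\mathrm{wnd}(u{\downarrow})$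 be $\mathrm{wnd}(u)$ with its first symbol deleted (and $\varepsilon$ if $\mathrm{wnd}(u)=\varepsilon$). Let $\mathrm{mwl}(u)$ be the maximum of $|\mathrm{wnd}(u')|$ over all prefixes $u'$ of $u$. For a streaming algorithm $P$ for $\mathrm{SW}(L)=\{u\mid \mathrm{wnd}(u)\in L\}$ put $v(P,n)=\log_2|\{P(u)\mid \mathrm{mwl}(u)\le n\}|$. Let $\mathsf V_L(n)$ be the minimum of $v(P,n)$ over all streaming algorithms $P$ for $\mathrm{SW}(L)$ (it is finite, and a single algorithm attains it for all $n$ simultaneously). **Language classes over $\Sigma$.** $\mathbf{Len}$ is the class of regular languages $K$ such that for every $n\ge 0$ either $\Sigma^n\subseteq K$ or $\Sigma^n\cap K=\emptyset$. $\mathbf{ST}$ is the class of finite Boolean combinations of languages $\Sigma^*w$ with $w\in\Sigma^*$. $\mathbf{LI}$ is the class of languages $\Sigma^*K$ with $K\subseteq\Sigma^*$ regular. $\langle\mathbf A,\mathbf B\rangle$ is the class of all finite Boolean combinations of languages from $\mathbf A\cup\mathbf B$. **Asymptotics.** For $f,g\colon\mathbb N\to\mathbb R_{\ge0}$, $f=\bar\Theta(g)$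 means that $f=O(g)$ and that there is $c>0$ with $f(n)\ge c\,g(n)$ for infinitely many $n$. The notations $O$ and $\Theta$ are the usual ones, as $n\to\infty$. **Theorem.** 1. $\mathsf F_L(n)$ is either $O(1)$, $\bar\Theta(\log n)$, or $\bar\Theta(n)$. Moreover, - $\mathsf F_L(n)=O(1)$ if and only if $L\in\langle\mathbf{ST},\mathbf{Len}\rangle$; - $\mathsf F_L(n)=O(\log n)$ if and only if $L\in\langle\mathbf{LI},\mathbf{Len}\rangle$. 2. $\mathsf V_L(n)$ is either $O(1)$, $\Theta(\log n)$, or $\Theta(n)$. Moreover, - $\mathsf V_L(n)=O(1)$ if and only if $L\in\{\emptyset,\Sigma^*\}$; - $\mathsf V_L(n)=O(\log n)$ if and only if $L\in\langle\mathbf{LI},\mathbf{Len}\rangle$. -/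

import Mathlib

open Filter Asymptotics
open scoped ENNReal

namespace SlidingWindow

universe u v

/-! ### Asymptotic notation -/

/-- `f = Ω̄(g)`: for some `c > 0`, `f n ≥ c * g n` holds for infinitely many `n`. -/
def IsBarOmega (f g : ℕ → ℝ) : Prop :=
  ∃ c : ℝ, 0 < c ∧ {n : ℕ | c * g n ≤ f n}.Infinite

/-- `f = Θ̄(g)`: `f = O(g)` and `f = Ω̄(g)`. -/
def IsBarTheta (f g : ℕ → ℝ) : Prop :=
  f =O[atTop] g ∧ IsBarOmega f g

/-! ### Streaming algorithms

A deterministic streaming algorithm is a deterministic automaton with a possibly infinite set of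
memory states; this is exactly Mathlib's `DFA`, which carries no finiteness condition. -/

/-- The number of bits `log₂ c` for `c` memory states, which is `∞` if `c = ∞`.
(A state set is never empty, so `c ≥ 1` in all uses and the logarithm is nonnegative.) -/
noncomputable def bits (c : ℕ∞) : ℝ≥0∞ :=
  if c = ⊤ then ⊤ else ENNReal.ofReal (Real.logb 2 (c.toNat : ℝ))

/-- The space `s(P) = log₂ |M|` of a streaming algorithm `P` with set `M` of memory states. -/
noncomputable def space {α : Type u} {σ : Type v} (_P : DFA α σ) : ℝ≥0∞ :=
  bits (ENat.card σ)

/-! ### The fixed-size model -/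

/-- The window `last_n(x)`: the suffix of length `n` of `x`, padded on the left with the symbol
`pad` if `x` is shorter than `n`. (Both subtractions are truncated.) -/
def lastWindow {α : Type u} (pad : α) (n : ℕ) (x : List α) : List α :=
  List.replicate (n - x.length) pad ++ x.drop (x.length - n)

/-- The fixed-size sliding window problem `SW_n(L)`. -/
def SWn {α : Type u} (pad : α) (L : Language α) (n : ℕ) : Language α :=
  {x : List α | lastWindow pad n x ∈ L}

/-- The infimum of the spaces of all streaming algorithms for `SW_n(L)`, as an extended number. -/
noncomputable def fixedSpaceENN {α : Type u} (pad : α) (L : Language α) (n : ℕ) : ℝ≥0∞ :=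
  ⨅ (σ : Type u) (P : DFA α σ) (_ : P.accepts = SWn pad L n), space P

/-- The space complexity `F_L(n)` in the fixed-size sliding window model
(the infimum is finite for a finite alphabet, see `fixedSpaceENN_ne_top`). -/
noncomputable def fixedSpace {α : Type u} (pad : α) (L : Language α) (n : ℕ) : ℝ :=
  (fixedSpaceENN pad L n).toReal

/-! ### The variable-size model

The extended alphabet is `Option α`: `some a` inserts `a`, and `none` is the pop operation. -/

/-- The effect of one operation on the active window; a pop leaves the empty window empty. -/
def windowStep {α : Type u} (w : List α) : Option α → List α
  | some a => w ++ [a]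
  | none => w.tail

/-- The active window `wnd(u)` after the stream `u`. -/
def window {α : Type u} (u : List (Option α)) : List α :=
  u.foldl windowStep []

/-- The variable-size sliding window problem `SW(L)`. -/
def SW {α : Type u} (L : Language α) : Language (Option α) :=
  {u : List (Option α) | window u ∈ L}

/-- The maximum window length `mwl(u)` over all prefixes of `u`. -/
def maxWindowLength {α : Type u} (u : List (Option α)) : ℕ :=
  (Finset.range (u.length + 1)).sup fun i => (window (u.take i)).length

/-- The set `M_{≤ n}` of memory states that `P` reaches on streams of maximum window length at
most `n`. -/
def statesUpTo {α : Type u} {σ : Type v} (P : DFA (Option α) σ) (n : ℕ) : Set σ :=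
  {q : σ | ∃ u : List (Option α), maxWindowLength u ≤ n ∧ P.eval u = q}

/-- The space complexity `v(P, n) = log₂ |M_{≤ n}|` of `P` in the variable-size model. -/
noncomputable def varSpaceOf {α : Type u} {σ : Type v} (P : DFA (Option α) σ) (n : ℕ) : ℝ≥0∞ :=
  bits (statesUpTo P n).encard

/-- The least `v(P, n)` over all streaming algorithms `P` for `SW(L)`, as an extended number.
By `exists_optimal` one single algorithm attains it for all `n`. -/
noncomputable def varSpaceENN {α : Type u} (L : Language α) (n : ℕ) : ℝ≥0∞ :=
  ⨅ (σ : Type u) (P : DFA (Option α) σ) (_ : P.accepts = SW L), varSpaceOf P n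

/-- The space complexity `V_L(n)` in the variable-size sliding window model
(it is finite for a finite alphabet, see `varSpaceENN_ne_top`). -/
noncomputable def varSpace {α : Type u} (L : Language α) (n : ℕ) : ℝ :=
  (varSpaceENN L n).toReal

/-! ### Language classes -/

/-- Regular length languages: regular, and every `Σ^n` is contained in or disjoint from `L`. -/
def regularLength (α : Type u) : Set (Language α) :=
  {L | L.IsRegular ∧
    ∀ n : ℕ, (∀ w : List α, w.length = n → w ∈ L) ∨ (∀ w : List α, w.length = n → w ∉ L)}

/-- Suffix-testable languages: finite Boolean combinations of languages `Σ* w`. -/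
def suffixTestable (α : Type u) : Set (Language α) :=
  BooleanSubalgebra.closure {L : Language α | ∃ w : List α, L = ⊤ * {w}}

/-- Regular left ideals: languages `Σ* K` with `K` regular. -/
def regularLeftIdeal (α : Type u) : Set (Language α) :=
  {L | ∃ K : Language α, K.IsRegular ∧ L = ⊤ * K}

/-! ### The space complexities are well defined -/

theorem bits_mono {c d : ℕ∞} (h : c ≤ d) : bits c ≤ bits d := by
  unfold bits
  by_cases hd : d = ⊤
  · simp [hd]
  · have hc : c ≠ ⊤ := fun hc => hd (top_le_iff.mp (hc ▸ h))
    simp only [hc, hd, if_false]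
    apply ENNReal.ofReal_le_ofReal
    have hn : c.toNat ≤ d.toNat := ENat.toNat_le_toNat h hd
    rcases Nat.eq_zero_or_pos c.toNat with h0 | h0
    · rw [h0]
      rcases Nat.eq_zero_or_pos d.toNat with h1 | h1
      · simp [h1]
      · simpa using Real.logb_nonneg (by norm_num) (by exact_mod_cast h1)
    · exact Real.logb_le_logb_of_le (by norm_num) (by exact_mod_cast h0) (by exact_mod_cast hn)

theorem bits_ne_top {c : ℕ∞} (h : c ≠ ⊤) : bits c ≠ ⊤ := by
  simp [bits, h]

theorem lastWindow_length {α : Type u} (pad : α) (n : ℕ) (x : List α) :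
    (lastWindow pad n x).length = n := by
  simp [lastWindow]; omega

theorem lastWindow_append_singleton {α : Type u} (pad : α) (n : ℕ) (x : List α) (a : α) :
    lastWindow pad n (x ++ [a]) = (lastWindow pad n x ++ [a]).drop 1 := by
  unfold lastWindow
  rcases Nat.lt_or_ge x.length n with h | h
  · have h1 : x.length - n = 0 := by omega
    have h2 : (x ++ [a]).length - n = 0 := by simp; omega
    obtain ⟨k, hk⟩ : ∃ k, n - x.length = k + 1 := ⟨n - x.length - 1, by omega⟩
    have h3 : n - (x ++ [a]).length = k := by simp; omega
    rw [h1, h2, h3, hk]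
    simp [List.replicate_succ]
  · have h1 : n - x.length = 0 := by omega
    have h2 : n - (x ++ [a]).length = 0 := by simp; omega
    have h3 : (x ++ [a]).length - n = (x.length - n) + 1 := by simp; omega
    rw [h1, h2, h3]
    simp only [List.replicate_zero, List.nil_append]
    rw [← List.drop_append_of_le_length (by omega : x.length - n ≤ x.length), List.drop_drop]

/-- `F_L(n)` is finite: some streaming algorithm for `SW_n(L)` has finitely many states. -/
theorem fixedSpaceENN_ne_top {α : Type u} [Finite α] (pad : α) (L : Language α) (n : ℕ) :
    fixedSpaceENN pad L n ≠ ⊤ := by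
  let P : DFA α {w : List α // w.length = n} :=
    { step := fun w a => ⟨(w.1 ++ [a]).drop 1, by simp [w.2]⟩
      start := ⟨lastWindow pad n [], lastWindow_length pad n []⟩
      accept := {w | w.1 ∈ L} }
  have hev : ∀ x : List α, (P.eval x).1 = lastWindow pad n x := by
    intro x
    induction x using List.reverseRecOn with
    | nil => rfl
    | append_singleton x a ih =>
      rw [DFA.eval_append_singleton, lastWindow_append_singleton, ← ih]
  have hP : P.accepts = SWn pad L n := by
    ext x
    rw [DFA.mem_accepts]
    change (P.eval x).1 ∈ L ↔ lastWindow pad n x ∈ L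
    rw [hev]
  have hfin : Finite {w : List α // w.length = n} := List.finite_length_eq α n
  refine ne_top_of_le_ne_top (b := space P) ?_ (iInf_le_of_le _ (iInf_le_of_le P (iInf_le _ hP)))
  exact bits_ne_top (by simp [ENat.card_eq_coe_natCard])

theorem window_length_le {α : Type u} (u : List (Option α)) :
    (window u).length ≤ maxWindowLength u := by
  have := Finset.le_sup (f := fun i => (window (u.take i)).length)
    (Finset.mem_range.mpr (Nat.lt_succ_self u.length))
  simpa [maxWindowLength] using this

/-- `V_L(n)` is finite. -/
theorem varSpaceENN_ne_top {α : Type u} [Finite α] (L : Language α) (n : ℕ) :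
    varSpaceENN L n ≠ ⊤ := by
  let P : DFA (Option α) (List α) :=
    { step := windowStep, start := [], accept := {w | w ∈ L} }
  have hP : P.accepts = SW L := rfl
  refine ne_top_of_le_ne_top (b := varSpaceOf P n) ?_
    (iInf_le_of_le _ (iInf_le_of_le P (iInf_le _ hP)))
  apply bits_ne_top
  rw [Set.encard_ne_top_iff]
  refine (List.finite_length_le α n).subset ?_
  rintro q ⟨u, hu, rfl⟩
  exact (window_length_le u).trans hu

/-- There is a streaming algorithm for `SW(L)` that is space optimal for all `n`
simultaneously. -/
theorem exists_optimal {α : Type u} (L : Language α) :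
    ∃ (σ : Type u) (P : DFA (Option α) σ), P.accepts = SW L ∧
      (∀ (τ : Type u) (Q : DFA (Option α) τ), Q.accepts = SW L →
        ∀ n, varSpaceOf P n ≤ varSpaceOf Q n) ∧
      ∀ n, varSpaceOf P n = varSpaceENN L n := by
  have key : ∀ (τ : Type u) (Q : DFA (Option α) τ), Q.accepts = SW L →
      ∀ n, varSpaceOf (SW L).toDFA n ≤ varSpaceOf Q n := by
    intro τ Q hQ n
    have hev : ∀ x, ((SW L).toDFA.eval x).1 = (SW L).leftQuotient x := by
      intro x
      induction x using List.reverseRecOn with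
      | nil => simp
      | append_singleton x a ih => simp [ih, Language.leftQuotient_append]
    apply bits_mono
    rw [← (Subtype.val_injective).encard_image (statesUpTo (SW L).toDFA n)]
    refine le_trans (Set.encard_le_encard (t := Q.acceptsFrom '' statesUpTo Q n) ?_)
      (Set.encard_image_le _ _)
    rintro _ ⟨_, ⟨u, hu, rfl⟩, rfl⟩
    refine ⟨Q.eval u, ⟨u, hu, rfl⟩, ?_⟩
    rw [hev, ← hQ, Language.leftQuotient_accepts_apply]
  refine ⟨_, (SW L).toDFA, Language.accepts_toDFA _, key, fun n => le_antisymm ?_ ?_⟩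
  · exact le_iInf fun τ => le_iInf fun Q => le_iInf fun hQ => key τ Q hQ n
  · exact iInf_le_of_le _ (iInf_le_of_le (SW L).toDFA (iInf_le _ (Language.accepts_toDFA _)))

end SlidingWindow

namespace SlidingWindow

universe u

/-! ### Space complexity and left quotients -/

/-! By Myhill–Nerode, both complexities are logarithms of numbers of left quotients: of all those of
`SWn pad L n` in the fixed-size model, and of those of `SW L` at streams with window length at most
`n` in the variable-size model. Thus everything reduces to counting quotients. Upper bounds:
quotient counts multiply under union and do not grow under complement, so only generators matter. A
length language needs only the window length (nothing at all if the size is fixed), and `Σ* w` in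
the fixed-size model only the last `|w|` symbols. For `Σ* K`, take a DFA for the reversal of `K` and
store, for each state, how far back into the window one must read from that state to accept; this
gives polynomially many summaries. Fixed-size windows are simulated by variable-size ones, so these
bounds carry over. Lower bounds: let `M` be a DFA for the reversal of `L`, reading the window from
the newest symbol backwards. If from a reachable state `q` two words of equal length, both
extendable to loops at `q`, differ in acceptance, then blocks of loops encode `N` bits in a window
of length linear in `N` (`two_pow_le_quotients`). Otherwise membership is determined by which pairs
of state and length residue occur at suffixes, which puts `L` in ⟨LI, Len⟩
(`mem_closure_leftIdeal_of_length_determined`). Likewise, either acceptance after `|M|` symbols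
depends only on the remaining length, which gives ⟨ST, Len⟩, or pumping a loop gives linearly many
quotients (`succ_le_quotients`). These bounds hold along an arithmetic progression of window sizes.
`varSpace` is monotone in `n`, so there the linear bound extends to all large `n`; in the fixed-size
model it holds only infinitely often. In the variable-size model, every nontrivial `L` moreover
forces about `log n` bits, since pops reveal the window length. -/

theorem eval_toDFA {β : Type*} (K : Language β) (x : List β) :
    (K.toDFA.eval x).1 = K.leftQuotient x := by
  induction x using List.reverseRecOn with
  | nil => simp
  | append_singleton x a ih => simp [ih, Language.leftQuotient_append]

theorem fixedSpaceENN_eq {α : Type u} (pad : α) (L : Language α) (n : ℕ) :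
    fixedSpaceENN pad L n = bits (Set.range (SWn pad L n).leftQuotient).encard := by
  apply le_antisymm
  · exact iInf_le_of_le _ (iInf_le_of_le (SWn pad L n).toDFA
      (iInf_le_of_le (Language.accepts_toDFA _) le_rfl))
  · refine le_iInf fun σ => le_iInf fun P => le_iInf fun hP => bits_mono ?_
    rw [← hP, Language.leftQuotient_accepts]
    refine (Set.encard_le_encard (Set.range_comp_subset_range _ _)).trans ?_
    rw [← Set.image_univ]
    exact (Set.encard_image_le _ _).trans (by rw [Set.encard_univ])

theorem varSpaceENN_eq {α : Type u} (L : Language α) (n : ℕ) :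
    varSpaceENN L n =
      bits ((SW L).leftQuotient '' {u | maxWindowLength u ≤ n}).encard := by
  have himage : ∀ {τ : Type u} (Q : DFA (Option α) τ), Q.accepts = SW L →
      (SW L).leftQuotient '' {u | maxWindowLength u ≤ n} = Q.acceptsFrom '' statesUpTo Q n := by
    intro τ Q hQ
    rw [← hQ, Language.leftQuotient_accepts, Set.image_comp]
    rfl
  apply le_antisymm
  · refine iInf_le_of_le _ (iInf_le_of_le (SW L).toDFA
      (iInf_le_of_le (Language.accepts_toDFA _) ?_))
    rw [varSpaceOf, ← (Subtype.val_injective).encard_image (statesUpTo (SW L).toDFA n)]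
    refine bits_mono (Set.encard_le_encard ?_)
    rintro _ ⟨_, ⟨u, hu, rfl⟩, rfl⟩
    exact ⟨u, hu, (eval_toDFA _ _).symm⟩
  · refine le_iInf fun σ => le_iInf fun P => le_iInf fun hP => bits_mono ?_
    rw [himage P hP]
    exact Set.encard_image_le _ _

theorem bits_natCast (k : ℕ) : bits (k : ℕ∞) = ENNReal.ofReal (Real.logb 2 k) := by
  simp [bits]

theorem logb_natCast_nonneg (k : ℕ) : 0 ≤ Real.logb 2 (k : ℝ) := by
  rw [Real.logb]
  exact div_nonneg (Real.log_natCast_nonneg k) (Real.log_nonneg (by norm_num))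

theorem bits_natCast_toReal (k : ℕ) : (bits (k : ℕ∞)).toReal = Real.logb 2 k := by
  rw [bits_natCast, ENNReal.toReal_ofReal (logb_natCast_nonneg k)]

section Bounds

variable {α : Type u} {pad : α} {L : Language α} {n k : ℕ}

theorem fixedSpace_le (h : (Set.range (SWn pad L n).leftQuotient).encard ≤ k) :
    fixedSpace pad L n ≤ Real.logb 2 k := by
  rw [fixedSpace, fixedSpaceENN_eq, ← bits_natCast_toReal]
  exact ENNReal.toReal_mono (bits_ne_top (by simp)) (bits_mono h)

theorem le_fixedSpace [Finite α] (h : k ≤ (Set.range (SWn pad L n).leftQuotient).encard) :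
    Real.logb 2 k ≤ fixedSpace pad L n := by
  rw [fixedSpace, ← bits_natCast_toReal]
  refine ENNReal.toReal_mono (fixedSpaceENN_ne_top pad L n) ?_
  rw [fixedSpaceENN_eq]
  exact bits_mono h

theorem varSpace_le
    (h : ((SW L).leftQuotient '' {u | maxWindowLength u ≤ n}).encard ≤ k) :
    varSpace L n ≤ Real.logb 2 k := by
  rw [varSpace, varSpaceENN_eq, ← bits_natCast_toReal]
  exact ENNReal.toReal_mono (bits_ne_top (by simp)) (bits_mono h)

theorem le_varSpace [Finite α]
    (h : k ≤ ((SW L).leftQuotient '' {u | maxWindowLength u ≤ n}).encard) :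
    Real.logb 2 k ≤ varSpace L n := by
  rw [varSpace, ← bits_natCast_toReal]
  refine ENNReal.toReal_mono (varSpaceENN_ne_top L n) ?_
  rw [varSpaceENN_eq]
  exact bits_mono h

end Bounds

theorem fixedSpace_nonneg {α : Type u} (pad : α) (L : Language α) (n : ℕ) :
    0 ≤ fixedSpace pad L n :=
  ENNReal.toReal_nonneg

theorem varSpace_nonneg {α : Type u} (L : Language α) (n : ℕ) : 0 ≤ varSpace L n :=
  ENNReal.toReal_nonneg

theorem varSpace_mono {α : Type u} [Finite α] (L : Language α) : Monotone (varSpace L) := by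
  intro m n h
  refine ENNReal.toReal_mono (varSpaceENN_ne_top L n) ?_
  rw [varSpaceENN_eq, varSpaceENN_eq]
  exact bits_mono (Set.encard_le_encard (Set.image_mono fun u hu => le_trans hu h))

theorem encard_image_le_of_factorsThrough {β γ δ : Type*} [Nonempty γ] {g : β → γ} {h : β → δ}
    (hgh : g.FactorsThrough h) (S : Set β) : (g '' S).encard ≤ (h '' S).encard := by
  obtain ⟨e, rfl⟩ := (Function.factorsThrough_iff g).mp hgh
  rw [Set.image_comp]
  exact Set.encard_image_le _ _

/-! ### Streams and windows -/

theorem window_append {α : Type u} (u v : List (Option α)) :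
    window (u ++ v) = v.foldl windowStep (window u) :=
  List.foldl_append

theorem maxWindowLength_append_singleton {α : Type u} (u : List (Option α)) (o : Option α) :
    maxWindowLength (u ++ [o]) = max (maxWindowLength u) (window (u ++ [o])).length := by
  have h1 : ∀ i ∈ Finset.range (u.length + 1),
      (window ((u ++ [o]).take i)).length = (window (u.take i)).length := by
    intro i hi
    rw [List.take_append_of_le_length (Nat.lt_succ_iff.mp (Finset.mem_range.mp hi))]
  have h2 : (u ++ [o]).take (u.length + 1) = u ++ [o] := List.take_of_length_le (by simp)
  rw [maxWindowLength, List.length_append, List.length_singleton, Finset.range_add_one,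
    Finset.sup_insert, Finset.sup_congr rfl h1, h2, sup_comm]
  rfl

theorem maxWindowLength_nil {α : Type u} : maxWindowLength ([] : List (Option α)) = 0 := by
  simp [maxWindowLength, window]

theorem window_map_some {α : Type u} (w : List α) : window (w.map some) = w := by
  induction w using List.reverseRecOn with
  | nil => rfl
  | append_singleton w a ih => rw [List.map_append, window_append, ih]; rfl

theorem maxWindowLength_map_some {α : Type u} (w : List α) :
    maxWindowLength (w.map some) = w.length := by
  induction w using List.reverseRecOn with
  | nil => exact maxWindowLength_nil
  | append_singleton w a ih =>
    have h := window_map_some (w ++ [a])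
    rw [List.map_append, List.map_singleton] at h ⊢
    rw [maxWindowLength_append_singleton, ih, h]
    simp

/-- The stream that simulates the fixed-size window of length `n` after reading `x`. -/
def slideStream {α : Type u} (pad : α) (n : ℕ) (x : List α) : List (Option α) :=
  (List.replicate n pad).map some ++ x.flatMap fun a => [none, some a]

theorem slideStream_append {α : Type u} (pad : α) (n : ℕ) (x y : List α) :
    slideStream pad n (x ++ y) = slideStream pad n x ++ y.flatMap fun a => [none, some a] := by
  simp [slideStream]

theorem slideStream_append_singleton {α : Type u} (pad : α) (n : ℕ) (x : List α) (a : α) :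
    slideStream pad n (x ++ [a]) = slideStream pad n x ++ [none] ++ [some a] := by
  simp [slideStream]

theorem window_slideStream {α : Type u} (pad : α) {n : ℕ} (hn : 0 < n) (x : List α) :
    window (slideStream pad n x) = lastWindow pad n x := by
  induction x using List.reverseRecOn with
  | nil =>
    have : slideStream pad n [] = (List.replicate n pad).map some := by simp [slideStream]
    rw [this, window_map_some]
    simp [lastWindow]
  | append_singleton x a ih =>
    rw [slideStream_append_singleton, window_append, window_append, ih,
      lastWindow_append_singleton, List.drop_append_of_le_length
        (by rw [lastWindow_length]; omega)]
    simp [windowStep]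

theorem maxWindowLength_slideStream {α : Type u} (pad : α) {n : ℕ} (hn : 0 < n) (x : List α) :
    maxWindowLength (slideStream pad n x) = n := by
  induction x using List.reverseRecOn with
  | nil =>
    have : slideStream pad n [] = (List.replicate n pad).map some := by simp [slideStream]
    rw [this, maxWindowLength_map_some, List.length_replicate]
  | append_singleton x a ih =>
    have h := window_slideStream pad hn (x ++ [a])
    rw [slideStream_append_singleton] at h ⊢
    rw [maxWindowLength_append_singleton, maxWindowLength_append_singleton, ih, h,
      lastWindow_length, window_append, window_slideStream pad hn]
    simp [windowStep, lastWindow_length]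

/-- Sliding a full window is a pop followed by an insertion. For `n = 0` this fails: the pop would
do nothing and the insertion would create a window of length one. -/
theorem fixed_quotients_le_var_quotients {α : Type u} (pad : α) (L : Language α) {n : ℕ}
    (hn : 0 < n) : (Set.range (SWn pad L n).leftQuotient).encard ≤
      ((SW L).leftQuotient '' {u | maxWindowLength u ≤ n}).encard := by
  have hmem : ∀ x y, y ∈ (SWn pad L n).leftQuotient x ↔
      (y.flatMap fun a => [none, some a]) ∈ (SW L).leftQuotient (slideStream pad n x) := by
    intro x y
    rw [Language.mem_leftQuotient, Language.mem_leftQuotient, ← slideStream_append]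
    change lastWindow pad n (x ++ y) ∈ L ↔ window (slideStream pad n (x ++ y)) ∈ L
    rw [window_slideStream pad hn]
  have hfac : (SWn pad L n).leftQuotient.FactorsThrough
      ((SW L).leftQuotient ∘ slideStream pad n) := by
    intro x x' h
    ext y
    rw [hmem, hmem]
    exact iff_of_eq (congrArg (_ ∈ ·) h)
  rw [← Set.image_univ]
  refine (encard_image_le_of_factorsThrough hfac _).trans (Set.encard_le_encard ?_)
  rintro _ ⟨x, -, rfl⟩
  exact ⟨_, (maxWindowLength_slideStream pad hn x).le, rfl⟩

theorem fixedSpace_le_varSpace {α : Type u} [Finite α] (pad : α) (L : Language α) {n : ℕ}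
    (hn : 0 < n) : fixedSpace pad L n ≤ varSpace L n := by
  refine ENNReal.toReal_mono (varSpaceENN_ne_top L n) ?_
  rw [fixedSpaceENN_eq, varSpaceENN_eq]
  exact bits_mono (fixed_quotients_le_var_quotients pad L hn)

/-! ### Upper bounds in the variable-size model -/

/-- A summary compatible with both operations, and deciding membership in `L`, is itself the memory
of a streaming algorithm. -/
theorem var_quotients_le_of_summary {α : Type u} {τ : Type*} {L : Language α} (f : List α → τ)
    (hstep : ∀ w w' o, f w = f w' → f (windowStep w o) = f (windowStep w' o))
    (hL : ∀ w w', f w = f w' → (w ∈ L ↔ w' ∈ L)) (n : ℕ) :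
    ((SW L).leftQuotient '' {u | maxWindowLength u ≤ n}).encard ≤
      (f '' {w | w.length ≤ n}).encard := by
  have hfold : ∀ (v : List (Option α)) w w', f w = f w' →
      f (v.foldl windowStep w) = f (v.foldl windowStep w') := by
    intro v
    induction v with
    | nil => exact fun _ _ h => h
    | cons o v ih => exact fun w w' h => ih _ _ (hstep w w' o h)
  have hfac : (SW L).leftQuotient.FactorsThrough (f ∘ window) := by
    intro u u' h
    ext v
    change window (u ++ v) ∈ L ↔ window (u' ++ v) ∈ L
    rw [window_append, window_append]
    exact hL _ _ (hfold v _ _ h)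
  refine (encard_image_le_of_factorsThrough hfac _).trans (Set.encard_le_encard ?_)
  rintro _ ⟨u, hu, rfl⟩
  exact ⟨window u, (window_length_le u).trans hu, rfl⟩

theorem encard_length_le {α : Type u} [Finite α] (n : ℕ) :
    {w : List α | w.length ≤ n}.encard ≤ (((Nat.card α + 1) ^ n : ℕ) : ℕ∞) := by
  -- A word of length at most `n` is a function on `n` positions, with `none` past its end.
  let g : List α → Fin n → Option α := fun w i => w[(i : ℕ)]?
  have hinj : Set.InjOn g {w : List α | w.length ≤ n} := by
    intro w hw w' hw' h
    apply List.ext_getElem?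
    intro i
    rcases lt_or_ge i n with hi | hi
    · exact congrFun h ⟨i, hi⟩
    · rw [List.getElem?_eq_none (le_trans hw hi), List.getElem?_eq_none (le_trans hw' hi)]
  rw [← hinj.encard_image]
  refine (Set.encard_le_encard (Set.subset_univ _)).trans ?_
  rw [Set.encard_univ, ENat.card_eq_coe_natCard, Nat.card_fun, Nat.card_fin, Finite.card_option]

theorem varSpace_le_linear {α : Type u} [Finite α] (L : Language α) (n : ℕ) :
    varSpace L n ≤ Real.logb 2 (Nat.card α + 1) * n := by
  have h := varSpace_le ((var_quotients_le_of_summary (L := L) id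
    (fun _ _ _ h => by rw [id.eq_def] at h; subst h; rfl)
    (fun _ _ h => by rw [id.eq_def] at h; subst h; rfl) n).trans
    (by rw [Set.image_id]; exact encard_length_le n))
  rw [Nat.cast_pow, Real.logb_pow] at h
  rw [mul_comm]
  exact_mod_cast h

/-! ### Polynomial quotient growth and Boolean operations -/

/-- On streams of maximum window length `n`, polynomially many states suffice for `SW(L)`. -/
def HasPolyQuotients {α : Type u} (L : Language α) : Prop :=
  ∃ C : ℕ, ∀ n, ((SW L).leftQuotient '' {u | maxWindowLength u ≤ n}).encard ≤
    (((n + 2) ^ C : ℕ) : ℕ∞)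

theorem encard_leftQuotient_compl_le {β : Type*} (K : Language β) (S : Set (List β)) :
    (Kᶜ.leftQuotient '' S).encard ≤ (K.leftQuotient '' S).encard := by
  refine encard_image_le_of_factorsThrough (fun x x' h => ?_) S
  exact congrArg compl h

theorem encard_leftQuotient_sup_le {β : Type*} (K K' : Language β) (S : Set (List β)) :
    ((K ⊔ K').leftQuotient '' S).encard ≤
      (K.leftQuotient '' S).encard * (K'.leftQuotient '' S).encard := by
  have hfac : (K ⊔ K').leftQuotient.FactorsThrough
      fun x => (K.leftQuotient x, K'.leftQuotient x) := by
    intro x x' h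
    exact congrArg (fun p : Language β × Language β => p.1 ⊔ p.2) h
  refine (encard_image_le_of_factorsThrough hfac S).trans ?_
  rw [← Set.encard_prod]
  refine Set.encard_le_encard ?_
  rintro _ ⟨x, hx, rfl⟩
  exact ⟨⟨x, hx, rfl⟩, ⟨x, hx, rfl⟩⟩

theorem encard_leftQuotient_bot_le {β : Type*} (S : Set (List β)) :
    ((⊥ : Language β).leftQuotient '' S).encard ≤ 1 := by
  rw [Set.encard_le_one_iff]
  rintro _ _ ⟨x, -, rfl⟩ ⟨y, -, rfl⟩
  rfl

theorem HasPolyQuotients.bot {α : Type u} : HasPolyQuotients (⊥ : Language α) :=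
  ⟨0, fun n => (encard_leftQuotient_bot_le _).trans (by simp)⟩

theorem HasPolyQuotients.compl {α : Type u} {L : Language α} (h : HasPolyQuotients L) :
    HasPolyQuotients Lᶜ := by
  obtain ⟨C, hC⟩ := h
  exact ⟨C, fun n => (encard_leftQuotient_compl_le (SW L) _).trans (hC n)⟩

theorem HasPolyQuotients.sup {α : Type u} {L L' : Language α} (h : HasPolyQuotients L)
    (h' : HasPolyQuotients L') : HasPolyQuotients (L ⊔ L') := by
  obtain ⟨C, hC⟩ := h
  obtain ⟨C', hC'⟩ := h'
  refine ⟨C + C', fun n => (encard_leftQuotient_sup_le (SW L) (SW L') _).trans ?_⟩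
  rw [pow_add, Nat.cast_mul]
  exact mul_le_mul' (hC n) (hC' n)

theorem HasPolyQuotients.of_length {α : Type u} {L : Language α} (hL : ∀ n : ℕ,
    (∀ w : List α, w.length = n → w ∈ L) ∨ (∀ w : List α, w.length = n → w ∉ L)) :
    HasPolyQuotients L := by
  refine ⟨1, fun n => (var_quotients_le_of_summary List.length ?_ ?_ n).trans ?_⟩
  · rintro w w' (_ | a) h <;> simp [windowStep, h]
  · intro w w' h
    rcases hL w.length with h1 | h1
    · exact iff_of_true (h1 _ rfl) (h1 _ h.symm)
    · exact iff_of_false (h1 _ rfl) (h1 _ h.symm)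
  · have hsub : List.length '' {w : List α | w.length ≤ n} ⊆ (Finset.range (n + 1) : Set ℕ) := by
      rintro _ ⟨w, hw, rfl⟩
      simpa [Nat.lt_succ_iff] using hw
    refine (Set.encard_le_encard hsub).trans ?_
    rw [Set.encard_coe_eq_coe_finsetCard, Finset.card_range]
    exact_mod_cast (by rw [pow_one]; omega : n + 1 ≤ (n + 2) ^ 1)

/-! ### Regular left ideals -/

open Classical in
/-- The length of the shortest prefix of a word that leads from `q` to an accepting state. -/
noncomputable def firstHit {α σ : Type*} (M : DFA α σ) : σ → List α → ℕ∞
  | q, [] => if q ∈ M.accept then 0 else ⊤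
  | q, a :: r => if q ∈ M.accept then 0 else firstHit M (M.step q a) r + 1

section FirstHit

variable {α σ : Type*} (M : DFA α σ)

theorem firstHit_of_mem {q : σ} (hq : q ∈ M.accept) (r : List α) : firstHit M q r = 0 := by
  cases r <;> simp [firstHit, hq]

theorem firstHit_cons_of_notMem {q : σ} (hq : q ∉ M.accept) (a : α) (r : List α) :
    firstHit M q (a :: r) = firstHit M (M.step q a) r + 1 := by
  simp [firstHit, hq]

theorem firstHit_ne_top_iff (q : σ) (r : List α) :
    firstHit M q r ≠ ⊤ ↔ ∃ s t, r = s ++ t ∧ M.evalFrom q s ∈ M.accept := by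
  induction r generalizing q with
  | nil =>
    by_cases hq : q ∈ M.accept
    · simp [firstHit, hq]
    · simp [firstHit, hq]
  | cons a r ih =>
    by_cases hq : q ∈ M.accept
    · rw [firstHit_of_mem M hq]
      exact iff_of_true (by simp) ⟨[], a :: r, rfl, hq⟩
    · rw [firstHit_cons_of_notMem M hq]
      have : firstHit M (M.step q a) r + 1 ≠ ⊤ ↔ firstHit M (M.step q a) r ≠ ⊤ := by
        simp
      rw [this, ih]
      constructor
      · rintro ⟨s, t, rfl, h⟩
        exact ⟨a :: s, t, rfl, h⟩
      · rintro ⟨s, t, h, hs⟩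
        cases s with
        | nil => exact absurd hs hq
        | cons b s =>
          obtain ⟨rfl, rfl⟩ := List.cons_eq_cons.mp h
          exact ⟨s, t, rfl, hs⟩

theorem firstHit_le_or_eq_top (q : σ) (r : List α) :
    firstHit M q r ≤ r.length ∨ firstHit M q r = ⊤ := by
  induction r generalizing q with
  | nil => by_cases hq : q ∈ M.accept <;> simp [firstHit, hq]
  | cons a r ih =>
    by_cases hq : q ∈ M.accept
    · simp [firstHit_of_mem M hq]
    · rw [firstHit_cons_of_notMem M hq]
      rcases ih (M.step q a) with h | h
      · left
        rw [List.length_cons, Nat.cast_add, Nat.cast_one]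
        gcongr
      · right
        simp [h]

-- With the window reversed, a pop deletes the last letter: a hit survives exactly if it lies within
-- the shortened word. Hence the new value depends only on the old one and the length.
open Classical in
theorem firstHit_dropLast (q : σ) (r : List α) :
    firstHit M q r.dropLast =
      if firstHit M q r ≤ ((r.length - 1 : ℕ) : ℕ∞) then firstHit M q r else ⊤ := by
  induction r generalizing q with
  | nil => by_cases hq : q ∈ M.accept <;> simp [firstHit, hq]
  | cons a r ih =>
    by_cases hq : q ∈ M.accept
    · simp [firstHit_of_mem M hq]
    · cases r with
      | nil => by_cases hq' : M.step q a ∈ M.accept <;> simp [firstHit, hq, hq']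
      | cons b r =>
        rw [List.dropLast_cons_cons, firstHit_cons_of_notMem M hq, firstHit_cons_of_notMem M hq, ih]
        simp only [List.length_cons, Nat.add_sub_cancel, Nat.cast_add, Nat.cast_one]
        have h : firstHit M (M.step q a) (b :: r) + 1 ≤ (r.length : ℕ∞) + 1 ↔
            firstHit M (M.step q a) (b :: r) ≤ (r.length : ℕ∞) :=
          ENat.add_le_add_iff_right (by simp)
        rw [if_congr h rfl rfl]
        split_ifs <;> simp

end FirstHit

theorem HasPolyQuotients.leftIdeal {α : Type u} {K : Language α} (hK : K.IsRegular) :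
    HasPolyQuotients (⊤ * K) := by
  classical
  obtain ⟨σ, _, M, hM⟩ := hK.reverse
  let f : List α → ℕ × (σ → ℕ∞) := fun w => (w.length, fun q => firstHit M q w.reverse)
  have hmem : ∀ w : List α, w ∈ ⊤ * K ↔ firstHit M M.start w.reverse ≠ ⊤ := by
    intro w
    have hacc : ∀ s : List α, M.evalFrom M.start s ∈ M.accept ↔ s.reverse ∈ K := by
      intro s
      rw [← Language.mem_reverse, ← hM]
      rfl
    rw [firstHit_ne_top_iff, Language.mem_mul]
    constructor
    · rintro ⟨a, -, b, hb, rfl⟩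
      exact ⟨b.reverse, a.reverse, by simp, by rw [hacc, List.reverse_reverse]; exact hb⟩
    · rintro ⟨s, t, h, hs⟩
      exact ⟨t.reverse, trivial, s.reverse, (hacc s).mp hs,
        by rw [← List.reverse_append, ← h, List.reverse_reverse]⟩
  -- One factor `n + 2` per state, for the hit values `0, …, n, ⊤`, and one more for the window
  -- length.
  refine ⟨Fintype.card σ + 1, fun n => (var_quotients_le_of_summary f ?_ ?_ n).trans ?_⟩
  · intro w w' o h
    have hlen : w.length = w'.length := congrArg Prod.fst h
    have hhit : ∀ q, firstHit M q w.reverse = firstHit M q w'.reverse := fun q =>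
      congrFun (congrArg Prod.snd h) q
    cases o with
    | some a =>
      refine Prod.ext (by simp [f, windowStep, hlen]) (funext fun q => ?_)
      simp only [f, windowStep, List.reverse_append, List.reverse_singleton, List.singleton_append,
        firstHit, hhit]
    | none =>
      refine Prod.ext (by simp [f, windowStep, hlen]) (funext fun q => ?_)
      simp only [f, windowStep, ← List.dropLast_reverse, firstHit_dropLast, hhit,
        List.length_reverse, hlen]
  · intro w w' h
    rw [hmem, hmem]
    exact not_congr (iff_of_eq (congrArg (fun p : ℕ × (σ → ℕ∞) => p.2 M.start = ⊤) h))
  · let B : Finset ℕ∞ := insert ⊤ ((Finset.range (n + 1)).image (fun i : ℕ => (i : ℕ∞)))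
    have hB : B.card ≤ n + 2 := by
      refine (Finset.card_insert_le _ _).trans ?_
      have := Finset.card_image_le (s := Finset.range (n + 1)) (f := fun i : ℕ => (i : ℕ∞))
      rw [Finset.card_range] at this
      omega
    have hsub : f '' {w : List α | w.length ≤ n} ⊆
        ((Finset.range (n + 1) ×ˢ Fintype.piFinset fun _ : σ => B :
          Finset (ℕ × (σ → ℕ∞))) : Set (ℕ × (σ → ℕ∞))) := by
      rintro _ ⟨w, hw, rfl⟩
      have hw' : w.length ≤ n := hw
      simp only [Finset.coe_product, Set.mem_prod, Finset.mem_coe, Finset.mem_range,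
        Fintype.mem_piFinset, f]
      refine ⟨Nat.lt_succ_of_le hw', fun q => ?_⟩
      rcases firstHit_le_or_eq_top M q w.reverse with h | h
      · rw [List.length_reverse] at h
        obtain ⟨i, hi⟩ := ENat.ne_top_iff_exists.mp (ne_top_of_le_ne_top (by simp) h)
        rw [← hi] at h ⊢
        refine Finset.mem_insert_of_mem (Finset.mem_image_of_mem _ (Finset.mem_range.mpr ?_))
        have : i ≤ w.length := by exact_mod_cast h
        omega
      · rw [h]
        exact Finset.mem_insert_self _ _
    refine (Set.encard_le_encard hsub).trans ?_
    rw [Set.encard_coe_eq_coe_finsetCard, Finset.card_product, Finset.card_range,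
      Fintype.card_piFinset, Finset.prod_const, Finset.card_univ, pow_succ, mul_comm]
    exact_mod_cast Nat.mul_le_mul (Nat.pow_le_pow_left hB _) (by omega)

theorem hasPolyQuotients_of_mem_closure {α : Type u} {L : Language α}
    (hL : L ∈ BooleanSubalgebra.closure (regularLeftIdeal α ∪ regularLength α)) :
    HasPolyQuotients L := by
  induction hL using BooleanSubalgebra.closure_bot_sup_induction with
  | mem K hK =>
    rcases hK with ⟨K, hK, rfl⟩ | hK
    · exact .leftIdeal hK
    · exact .of_length hK.2
  | bot => exact .bot
  | sup K _ K' _ h h' => exact h.sup h'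
  | compl K _ h => exact h.compl

/-! ### Upper bounds in the fixed-size model -/

/-- The fixed-size problems `SW_n(L)` need boundedly many states. -/
def HasBoundedQuotients {α : Type u} (pad : α) (L : Language α) : Prop :=
  ∃ C : ℕ, ∀ n, (Set.range (SWn pad L n).leftQuotient).encard ≤ (C : ℕ∞)

section BoundedQuotients

variable {α : Type u} {pad : α} {L L' : Language α}

theorem HasBoundedQuotients.bot : HasBoundedQuotients pad (⊥ : Language α) :=
  ⟨1, fun n => by
    rw [← Set.image_univ]
    exact encard_leftQuotient_bot_le _⟩

theorem HasBoundedQuotients.compl (h : HasBoundedQuotients pad L) :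
    HasBoundedQuotients pad Lᶜ := by
  obtain ⟨C, hC⟩ := h
  refine ⟨C, fun n => le_trans ?_ (hC n)⟩
  rw [← Set.image_univ, ← Set.image_univ]
  exact encard_leftQuotient_compl_le (SWn pad L n) _

theorem HasBoundedQuotients.sup (h : HasBoundedQuotients pad L)
    (h' : HasBoundedQuotients pad L') : HasBoundedQuotients pad (L ⊔ L') := by
  obtain ⟨C, hC⟩ := h
  obtain ⟨C', hC'⟩ := h'
  refine ⟨C * C', fun n => ?_⟩
  have h1 := hC n
  have h2 := hC' n
  rw [← Set.image_univ] at h1 h2 ⊢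
  refine (encard_leftQuotient_sup_le (SWn pad L n) (SWn pad L' n) _).trans ?_
  rw [Nat.cast_mul]
  exact mul_le_mul' h1 h2

theorem HasBoundedQuotients.of_length (hL : ∀ n : ℕ,
    (∀ w : List α, w.length = n → w ∈ L) ∨ (∀ w : List α, w.length = n → w ∉ L)) :
    HasBoundedQuotients pad L := by
  refine ⟨1, fun n => ?_⟩
  rw [Nat.cast_one, Set.encard_le_one_iff]
  rintro _ _ ⟨x, rfl⟩ ⟨y, rfl⟩
  ext z
  change lastWindow pad n (x ++ z) ∈ L ↔ lastWindow pad n (y ++ z) ∈ L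
  rcases hL n with h | h
  · exact iff_of_true (h _ (lastWindow_length ..)) (h _ (lastWindow_length ..))
  · exact iff_of_false (h _ (lastWindow_length ..)) (h _ (lastWindow_length ..))

/-- The padding is consistent: a smaller padded window is always a suffix of a larger one. -/
theorem lastWindow_eq_drop (pad : α) {k n : ℕ} (hk : k ≤ n) (x : List α) :
    lastWindow pad k x = (lastWindow pad n x).drop (n - k) := by
  induction x using List.reverseRecOn with
  | nil => simp [lastWindow, Nat.sub_sub_self hk]
  | append_singleton x a ih =>
    have h := lastWindow_length pad n x
    rw [lastWindow_append_singleton, lastWindow_append_singleton, ih,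
      ← List.drop_append_of_le_length (by omega), List.drop_drop, List.drop_drop, add_comm]

theorem lastWindow_append_congr {k : ℕ} {x x' : List α}
    (h : lastWindow pad k x = lastWindow pad k x') (z : List α) :
    lastWindow pad k (x ++ z) = lastWindow pad k (x' ++ z) := by
  induction z using List.reverseRecOn with
  | nil => simpa using h
  | append_singleton z a ih =>
    rw [← List.append_assoc, ← List.append_assoc, lastWindow_append_singleton,
      lastWindow_append_singleton, ih]

theorem lastWindow_mem_top_mul_singleton {w : List α} {n : ℕ} (hw : w.length ≤ n) (x : List α) :
    lastWindow pad n x ∈ (⊤ * {w} : Language α) ↔ lastWindow pad w.length x = w := by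
  rw [Language.mem_mul, lastWindow_eq_drop pad hw]
  have hn := lastWindow_length pad n x
  constructor
  · rintro ⟨a, -, b, rfl, h⟩
    have : n - b.length = a.length := by
      have := congrArg List.length h
      rw [List.length_append] at this
      omega
    rw [← h, this, List.drop_left]
  · intro h
    refine ⟨(lastWindow pad n x).take (n - w.length), trivial, w, rfl, ?_⟩
    have h' := List.take_append_drop (n - w.length) (lastWindow pad n x)
    rwa [h] at h'

theorem HasBoundedQuotients.suffix [Finite α] (w : List α) :
    HasBoundedQuotients pad (⊤ * {w} : Language α) := by
  have hfin : {v : List α | v.length = w.length}.Finite := List.finite_length_eq α w.length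
  refine ⟨{v : List α | v.length = w.length}.ncard + 1, fun n => ?_⟩
  rcases le_or_gt w.length n with hw | hw
  · have hfac : (SWn pad (⊤ * {w}) n).leftQuotient.FactorsThrough
        (lastWindow pad w.length) := by
      intro x x' h
      ext z
      change lastWindow pad n (x ++ z) ∈ (⊤ * {w} : Language α) ↔
        lastWindow pad n (x' ++ z) ∈ (⊤ * {w} : Language α)
      rw [lastWindow_mem_top_mul_singleton hw, lastWindow_mem_top_mul_singleton hw,
        lastWindow_append_congr h]
    rw [← Set.image_univ]
    refine (encard_image_le_of_factorsThrough hfac _).trans ?_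
    refine (Set.encard_le_encard (t := {v : List α | v.length = w.length}) ?_).trans ?_
    · rintro _ ⟨x, -, rfl⟩
      exact lastWindow_length _ _ _
    · rw [← hfin.cast_ncard_eq]
      exact_mod_cast Nat.le_succ _
  -- A window shorter than `w` never ends in `w`, so the problem is empty.
  · have hno : ∀ x, lastWindow pad n x ∉ (⊤ * {w} : Language α) := by
      rintro x ⟨a, -, b, rfl, h⟩
      have := congrArg List.length h
      simp only [List.length_append, lastWindow_length] at this
      omega
    refine le_trans ?_ (by exact_mod_cast Nat.le_add_left 1 _ : (1 : ℕ∞) ≤ _)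
    rw [Set.encard_le_one_iff]
    rintro _ _ ⟨x, rfl⟩ ⟨y, rfl⟩
    ext z
    exact iff_of_false (hno _) (hno _)

theorem hasBoundedQuotients_of_mem_closure [Finite α]
    (hL : L ∈ BooleanSubalgebra.closure (suffixTestable α ∪ regularLength α)) :
    HasBoundedQuotients pad L := by
  induction hL using BooleanSubalgebra.closure_bot_sup_induction with
  | mem K hK =>
    rcases hK with hK | hK
    · induction hK using BooleanSubalgebra.closure_bot_sup_induction with
      | mem K hK =>
        obtain ⟨w, rfl⟩ := hK
        exact .suffix w
      | bot => exact .bot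
      | sup K _ K' _ h h' => exact h.sup h'
      | compl K _ h => exact h.compl
    · exact .of_length hK.2
  | bot => exact .bot
  | sup K _ K' _ h h' => exact h.sup h'
  | compl K _ h => exact h.compl

end BoundedQuotients

/-! ### Lower bounds

Windows are read from the most recent symbol backwards, by an automaton `M` for the reversed
language. -/

section LowerBounds

variable {α : Type u} {σ : Type*} {pad : α} {L : Language α} {M : DFA α σ}

theorem reverse_mem_SWn_iff (hM : M.accepts = L.reverse) {n : ℕ} {r : List α}
    (hn : n ≤ r.length) : r.reverse ∈ SWn pad L n ↔ M.eval (r.take n) ∈ M.accept := by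
  rw [← DFA.mem_accepts, hM, Language.mem_reverse]
  change lastWindow pad n r.reverse ∈ L ↔ _
  have h : n - r.reverse.length = 0 := by simp [hn]
  rw [lastWindow, h, List.replicate_zero, List.nil_append, List.length_reverse,
    List.drop_reverse, Nat.sub_sub_self hn]

/-- A family of reversed streams that are pairwise separated by recent symbols bounds the number
of states from below. -/
theorem card_le_quotients (hM : M.accepts = L.reverse) {n : ℕ} {ι : Type*} [Fintype ι]
    (s : ι → List α)
    (hs : ∀ i j, (∀ p : List α, n ≤ (p ++ s i).length → n ≤ (p ++ s j).length →
      (M.eval ((p ++ s i).take n) ∈ M.accept ↔ M.eval ((p ++ s j).take n) ∈ M.accept)) → i = j) :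
    (Fintype.card ι : ℕ∞) ≤ (Set.range (SWn pad L n).leftQuotient).encard := by
  -- Streams are reversed, so the prefix `p` is the input still to come.
  have hinj : Function.Injective fun i => (SWn pad L n).leftQuotient (s i).reverse := by
    intro i j h
    refine hs i j fun p hi hj => ?_
    rw [← reverse_mem_SWn_iff (pad := pad) hM hi, ← reverse_mem_SWn_iff (pad := pad) hM hj,
      List.reverse_append, List.reverse_append, ← Language.mem_leftQuotient,
      ← Language.mem_leftQuotient]
    exact iff_of_eq (congrArg (p.reverse ∈ ·) h)
  rw [← ENat.card_eq_coe_fintype_card, ← Set.encard_univ, ← hinj.encard_image]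
  refine Set.encard_le_encard ?_
  rintro _ ⟨i, -, rfl⟩
  exact ⟨_, rfl⟩

theorem evalFrom_flatMap_eq {ι : Type*} {q : σ} {f : ι → List α}
    (hf : ∀ i, M.evalFrom q (f i) = q) (l : List ι) : M.evalFrom q (l.flatMap f) = q := by
  induction l with
  | nil => rfl
  | cons i l ih => rw [List.flatMap_cons, DFA.evalFrom_of_append, hf, ih]

theorem length_flatMap_eq {ι : Type*} {k : ℕ} {f : ι → List α}
    (hf : ∀ i, (f i).length = k) (l : List ι) : (l.flatMap f).length = l.length * k := by
  simp [List.length_flatMap, hf]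

/-- Each bit is a loop at `q` containing both given loops, with the bit deciding which comes first.
If the window ends `u.length` symbols into a block, acceptance reveals that bit. -/
theorem two_pow_le_quotients (hM : M.accepts = L.reverse) {x u u' v v' : List α} {q : σ}
    (hx : M.eval x = q) (hlen : u.length = v.length) (hu : M.evalFrom q (u ++ u') = q)
    (hv : M.evalFrom q (v ++ v') = q) (hua : M.evalFrom q u ∈ M.accept)
    (hva : M.evalFrom q v ∉ M.accept) (N : ℕ) :
    ((2 ^ N : ℕ) : ℕ∞) ≤ (Set.range (SWn pad L
      (x.length + N * (u ++ u' ++ (v ++ v')).length + u.length)).leftQuotient).encard := by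
  let f : Bool → List α := fun b => cond b (u ++ u' ++ (v ++ v')) (v ++ v' ++ (u ++ u'))
  set k := (u ++ u' ++ (v ++ v')).length with hk
  have hfq : ∀ b, M.evalFrom q (f b) = q := by
    rintro (_ | _) <;> simp only [f, cond_true, cond_false] <;>
      rw [DFA.evalFrom_of_append] <;> simp only [hu, hv]
  have hfl : ∀ b, (f b).length = k := by
    rintro (_ | _)
    · simp only [f, cond_false, hk, List.length_append]; omega
    · rfl
  have hft : ∀ b t, M.evalFrom q ((f b ++ t).take u.length) ∈ M.accept ↔ b = true := by
    rintro (_ | _) t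
    · simp only [f, cond_false, List.append_assoc]
      rw [hlen, List.take_left]
      simpa using hva
    · simp only [f, cond_true, List.append_assoc]
      rw [List.take_left]
      simpa using hua
  -- Prepending `x` and `N - i` further blocks places exactly `N` blocks before the `i`-th cut, so
  -- one window length serves every bit.
  have key : ∀ (l : List Bool) (hl : l.length = N) (i : ℕ) (hi : i < N),
      M.eval ((x ++ (List.replicate (N - i) true).flatMap f ++ l.flatMap f).take
        (x.length + N * k + u.length)) ∈ M.accept ↔ l[i] = true := by
    intro l hl i hi
    have hsplit : l = l.take i ++ l[i] :: l.drop (i + 1) := by simp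
    have hfm : l.flatMap f =
        (l.take i).flatMap f ++ (f l[i] ++ (l.drop (i + 1)).flatMap f) := by
      rw [← List.flatMap_cons, ← List.flatMap_append, ← hsplit]
    have heq : x ++ (List.replicate (N - i) true).flatMap f ++ l.flatMap f =
        (x ++ (List.replicate (N - i) true ++ l.take i).flatMap f) ++
          (f l[i] ++ (l.drop (i + 1)).flatMap f) := by
      rw [hfm, List.flatMap_append]
      simp only [List.append_assoc]
    have hlen' : (x ++ (List.replicate (N - i) true ++ l.take i).flatMap f).length =
        x.length + N * k := by
      have h1 : min i N = i := min_eq_left hi.le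
      rw [List.length_append, length_flatMap_eq hfl, List.length_append, List.length_replicate,
        List.length_take, hl, h1, Nat.sub_add_cancel hi.le]
    rw [heq, ← hlen', List.take_length_add_append, DFA.eval, DFA.evalFrom_of_append,
      DFA.evalFrom_of_append]
    change M.evalFrom (M.evalFrom (M.eval x) _) _ ∈ _ ↔ _
    rw [hx, evalFrom_flatMap_eq hfq, hft]
  have hcard : Fintype.card (Fin N → Bool) = 2 ^ N := by simp
  rw [← hcard]
  refine card_le_quotients hM (fun b => (List.ofFn b).flatMap f) fun b b' h => ?_
  funext i
  have hl : ∀ b : Fin N → Bool, x.length + N * k + u.length ≤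
      (x ++ (List.replicate (N - i) true).flatMap f ++ (List.ofFn b).flatMap f).length := by
    intro b
    have hku : u.length ≤ k := by simp [hk]
    have hNi : 1 ≤ N - i := by omega
    rw [List.length_append, List.length_append, length_flatMap_eq hfl, length_flatMap_eq hfl,
      List.length_replicate, List.length_ofFn]
    have := Nat.mul_le_mul_right k hNi
    omega
  have h' := h _ (hl b) (hl b')
  rw [key _ List.length_ofFn i i.2, key _ List.length_ofFn i i.2] at h'
  simpa using Bool.eq_iff_iff.mpr h'

/-- The reversed streams are `c^i t`. For `i < j`, prepending `x c^(N-i)` makes the window `x c^N t`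
in one case and `x c^N` followed by a prefix of `c` in the other. -/
theorem succ_le_quotients (hM : M.accepts = L.reverse) {x c t : List α} {q : σ}
    (hx : M.eval x = q) (hc : M.evalFrom q c = q) (ht : t.length ≤ c.length)
    (hta : ¬(M.evalFrom q t ∈ M.accept ↔ M.evalFrom q (c.take t.length) ∈ M.accept)) (N : ℕ) :
    ((N + 1 : ℕ) : ℕ∞) ≤ (Set.range (SWn pad L
      (x.length + N * c.length + t.length)).leftQuotient).encard := by
  let f : Unit → List α := fun _ => c
  let pw : ℕ → List α := fun i => (List.replicate i ()).flatMap f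
  have hpq : ∀ i, M.evalFrom q (pw i) = q := fun i => evalFrom_flatMap_eq (fun _ => hc) _
  have hpl : ∀ i, (pw i).length = i * c.length := fun i => by
    rw [length_flatMap_eq (k := c.length) (fun _ => rfl), List.length_replicate]
  have hadd : ∀ i j, pw (i + j) = pw i ++ pw j := fun i j => by
    simp only [pw, List.replicate_add, List.flatMap_append]
  have heval : ∀ r, M.eval ((x ++ pw N ++ r).take (x.length + N * c.length + t.length)) =
      M.evalFrom q (r.take t.length) := by
    intro r
    have hlen : x.length + N * c.length = (x ++ pw N).length := by rw [List.length_append, hpl]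
    rw [hlen, List.take_length_add_append, DFA.eval, DFA.evalFrom_of_append,
      DFA.evalFrom_of_append]
    change M.evalFrom (M.evalFrom (M.eval x) _) _ = _
    rw [hx, hpq]
  have hlt : ∀ i j : Fin (N + 1), i < j →
      ¬∀ p : List α, x.length + N * c.length + t.length ≤ (p ++ (pw i ++ t)).length →
      x.length + N * c.length + t.length ≤ (p ++ (pw j ++ t)).length →
      (M.eval ((p ++ (pw i ++ t)).take (x.length + N * c.length + t.length)) ∈ M.accept ↔
        M.eval ((p ++ (pw j ++ t)).take (x.length + N * c.length + t.length)) ∈ M.accept) := by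
    intro i j hij h
    have hN : pw N = pw (N - i) ++ pw i := by
      rw [← hadd]
      exact congrArg pw (by omega)
    have hi : x ++ pw (N - i) ++ (pw i ++ t) = x ++ pw N ++ t := by
      rw [hN]
      simp only [List.append_assoc]
    have hj : x ++ pw (N - i) ++ (pw j ++ t) = x ++ pw N ++ (c ++ (pw (j - i - 1) ++ t)) := by
      have h2 : pw j = pw i ++ (pw 1 ++ pw (j - i - 1)) := by
        rw [← hadd, ← hadd]
        exact congrArg pw (by omega)
      have h3 : pw 1 = c := by simp [pw, f]
      rw [hN, h2, h3]
      simp only [List.append_assoc]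
    have h' := h (x ++ pw (N - i))
    rw [hi, hj, heval, heval, List.take_length, List.take_append_of_le_length ht] at h'
    refine hta (h' ?_ ?_)
    · simp only [List.length_append, hpl]; omega
    · simp only [List.length_append, hpl]; omega
  have hcard : Fintype.card (Fin (N + 1)) = N + 1 := by simp
  rw [← hcard]
  refine card_le_quotients hM (fun i : Fin (N + 1) => pw i ++ t) fun i j h => ?_
  rcases lt_trichotomy i j with hij | hij | hij
  · exact absurd h (hlt i j hij)
  · exact hij
  · exact absurd (fun p h1 h2 => (h p h2 h1).symm) (hlt j i hij)

end LowerBounds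

/-- Every nontrivial language requires the window length to be stored. -/
theorem succ_le_var_quotients {α : Type u} {L : Language α} (h0 : L ≠ ⊥) (h1 : L ≠ ⊤) (n : ℕ) :
    ((n + 1 : ℕ) : ℕ∞) ≤ ((SW L).leftQuotient '' {u | maxWindowLength u ≤ n}).encard := by
  classical
  -- Take a shortest `x` whose membership differs from that of the empty word.
  have hex : ∃ k, ∃ w : List α, w.length = k ∧ ¬(w ∈ L ↔ [] ∈ L) := by
    by_contra hcon
    push Not at hcon
    by_cases hnil : [] ∈ L
    · exact h1 (top_unique fun w _ => (hcon _ w rfl).mpr hnil)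
    · exact h0 (bot_unique fun w hw => hnil ((hcon _ w rfl).mp hw))
  obtain ⟨x, hxlen, hx⟩ := Nat.find_spec hex
  have hmin : ∀ y : List α, y.length < x.length → (y ∈ L ↔ [] ∈ L) := by
    intro y hy
    by_contra hcon
    exact Nat.find_min hex (hxlen ▸ hy) ⟨y, rfl, hcon⟩
  have hxne : 0 < x.length := by
    rw [List.length_pos_iff]
    rintro rfl
    exact hx Iff.rfl
  obtain ⟨a⟩ : Nonempty α := ⟨x.head (List.length_pos_iff.mp hxne)⟩
  let s : ℕ → List (Option α) := fun i => (List.replicate i a).map some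
  have hpop : ∀ (j : ℕ) (w : List α),
      (List.replicate j (none : Option α)).foldl windowStep w = w.drop j := by
    intro j
    induction j with
    | zero => intro w; rfl
    | succ j ih =>
      intro w
      rw [List.replicate_succ, List.foldl_cons, ih]
      simp [windowStep]
  have hwin : ∀ i j, window (s i ++ (x.map some ++ List.replicate j none)) =
      (List.replicate i a ++ x).drop j := by
    intro i j
    rw [← List.append_assoc, window_append, hpop, ← List.map_append, window_map_some]
  have hlt : ∀ i j, i < j → (SW L).leftQuotient (s i) ≠ (SW L).leftQuotient (s j) := by
    intro i j hij h
    -- Appending `x` and popping `j` times leaves `x` itself from `a^j`, but a strictly shorter word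
    -- from `a^i`; by minimality their memberships differ.
    have h' : window (s i ++ (x.map some ++ List.replicate j none)) ∈ L ↔
        window (s j ++ (x.map some ++ List.replicate j none)) ∈ L :=
      iff_of_eq (congrArg ((x.map some ++ List.replicate j none) ∈ ·) h)
    have hi : (List.replicate i a).drop j = [] := List.drop_of_length_le (by simp; omega)
    have hj : (List.replicate j a).drop j = [] := List.drop_of_length_le (by simp)
    rw [hwin, hwin, List.drop_append, List.drop_append, hi, hj] at h'
    simp only [List.length_replicate, Nat.sub_self, List.drop_zero, List.nil_append] at h'
    rw [hmin _ (by rw [List.length_drop]; omega)] at h'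
    exact hx h'.symm
  have hinj : Function.Injective fun i => (SW L).leftQuotient (s i) := by
    intro i j h
    rcases lt_trichotomy i j with hij | hij | hij
    · exact absurd h (hlt i j hij)
    · exact hij
    · exact absurd h.symm (hlt j i hij)
  rw [← Finset.card_range (n + 1), ← Set.encard_coe_eq_coe_finsetCard, ← hinj.encard_image]
  refine Set.encard_le_encard ?_
  rintro _ ⟨i, hi, rfl⟩
  refine ⟨s i, ?_, rfl⟩
  change maxWindowLength (s i) ≤ n
  rw [maxWindowLength_map_some, List.length_replicate]
  exact Nat.lt_succ_iff.mp (Finset.mem_range.mp hi)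

/-! ### Membership in the language classes -/

/-- A language belongs to a Boolean algebra of languages if membership in it only depends on
membership in finitely many languages of the algebra. -/
theorem mem_booleanSubalgebra_of_separating {α ι : Type*} [Finite ι]
    {A : BooleanSubalgebra (Language α)} (S : ι → Language α) (hS : ∀ i, S i ∈ A)
    {L : Language α} (h : ∀ w w', (∀ i, w ∈ S i ↔ w' ∈ S i) → w ∈ L → w' ∈ L) : L ∈ A := by
  classical
  let cell : Set ι → Language α := fun T => ⨅ i, if i ∈ T then S i else (S i)ᶜ
  have hcell : ∀ T w, w ∈ cell T ↔ ∀ i, (w ∈ S i ↔ i ∈ T) := by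
    intro T w
    refine Set.mem_iInter.trans (forall_congr' fun i => ?_)
    by_cases hi : i ∈ T
    · simp only [hi, iff_true]
      rfl
    · simp only [hi, iff_false]
      rfl
  -- `L` is the union of the finitely many atoms of the `S i` that meet it.
  have hL : L = ⨆ T : {T : Set ι // ∃ w ∈ L, ∀ i, (w ∈ S i ↔ i ∈ T)}, cell T := by
    ext w
    refine Iff.trans ?_ Set.mem_iUnion.symm
    constructor
    · intro hw
      exact ⟨⟨{i | w ∈ S i}, w, hw, fun i => Iff.rfl⟩, (hcell _ _).mpr fun i => Iff.rfl⟩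
    · rintro ⟨⟨T, w', hw', hT⟩, hw⟩
      exact h w' w (fun i => (hT i).trans ((hcell _ _).mp hw i).symm) hw'
  rw [hL]
  refine BooleanSubalgebra.iSup_mem fun T => BooleanSubalgebra.iInf_mem fun i => ?_
  split_ifs
  · exact hS i
  · exact BooleanSubalgebra.compl_mem (hS i)

theorem isRegular_length_mod {α : Type u} (d : ℕ) [NeZero d] (r : ZMod d) :
    Language.IsRegular ({w | (w.length : ZMod d) = r} : Language α) := by
  let M : DFA α (ZMod d) := { step := fun s _ => s + 1, start := 0, accept := {r} }
  have hev : ∀ w, M.eval w = (w.length : ZMod d) := by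
    intro w
    induction w using List.reverseRecOn with
    | nil => simp [M]
    | append_singleton w a ih => rw [DFA.eval_append_singleton, ih]; simp [M]
  refine ⟨ZMod d, ZMod.fintype d, M, ?_⟩
  ext w
  rw [DFA.mem_accepts, hev]
  rfl

theorem length_mod_mem_regularLength {α : Type u} (d : ℕ) [NeZero d] (r : ZMod d) :
    ({w | (w.length : ZMod d) = r} : Language α) ∈ regularLength α := by
  refine ⟨isRegular_length_mod d r, fun n => ?_⟩
  by_cases h : (n : ZMod d) = r
  · exact Or.inl fun w hw => by rw [← hw] at h; exact h
  · exact Or.inr fun w hw => by rw [← hw] at h; exact h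

/-- After the first letter, the quotients are those of `L`; only the quotient at the empty word is
new. -/
theorem isRegular_preimage_tail {α : Type u} {L : Language α} (hL : L.IsRegular) :
    Language.IsRegular ({w | w.tail ∈ L} : Language α) := by
  refine Language.IsRegular.of_finite_range_leftQuotient
    ((hL.finite_range_leftQuotient.insert ({w | w.tail ∈ L} : Language α)).subset ?_)
  rintro _ ⟨_ | ⟨a, u⟩, rfl⟩
  · exact Or.inl rfl
  · exact Or.inr ⟨u, rfl⟩

/-- This tests acceptance on one representative of each length. Regularity for the shift `k` follows
by applying `tail` `k` times, which matches truncated subtraction. -/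
theorem unary_mem_regularLength {α : Type u} {σ : Type} [Fintype σ] (M : DFA α σ) (q : σ)
    (a : α) (k : ℕ) : ({w | M.evalFrom q (List.replicate (w.length - k) a) ∈ M.accept} :
      Language α) ∈ regularLength α := by
  constructor
  · induction k with
    | zero =>
      let P : DFA α σ := { step := fun s _ => M.step s a, start := q, accept := M.accept }
      have hev : ∀ w, P.eval w = M.evalFrom q (List.replicate w.length a) := by
        intro w
        induction w using List.reverseRecOn with
        | nil => rfl
        | append_singleton w b ih =>
          rw [DFA.eval_append_singleton, ih, List.length_append, List.length_singleton,
            List.replicate_succ', DFA.evalFrom_append_singleton]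
      refine ⟨σ, inferInstance, P, ?_⟩
      ext w
      rw [DFA.mem_accepts, hev]
      rfl
    | succ k ih =>
      refine (congrArg Language.IsRegular (Set.ext fun w => ?_)).mpr (isRegular_preimage_tail ih)
      change M.evalFrom q (List.replicate (w.length - (k + 1)) a) ∈ M.accept ↔
        M.evalFrom q (List.replicate (w.tail.length - k) a) ∈ M.accept
      rw [List.length_tail, Nat.sub_sub, add_comm]
  · intro n
    by_cases h : M.evalFrom q (List.replicate (n - k) a) ∈ M.accept
    · exact Or.inl fun w hw => by rw [← hw] at h; exact h
    · exact Or.inr fun w hw => by rw [← hw] at h; exact h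

section Classification

variable {α : Type u} {L : Language α} {σ : Type} {M : DFA α σ}

theorem mem_iff_eval_reverse (hM : M.accepts = L.reverse) (w : List α) :
    w ∈ L ↔ M.eval w.reverse ∈ M.accept := by
  rw [← DFA.mem_accepts, hM, Language.mem_reverse, List.reverse_reverse]

theorem eval_reverse_append (a b : List α) :
    M.eval (a ++ b).reverse = M.evalFrom (M.eval b.reverse) a.reverse := by
  rw [List.reverse_append, DFA.eval, DFA.evalFrom_of_append]

variable [Fintype σ]

/-- Choose one loop length per state lying on a loop; their product is a common multiple, and loops
can be repeated. -/
theorem exists_common_loop_length (M : DFA α σ) : ∃ d : ℕ, 0 < d ∧ ∀ q c, M.evalFrom q c = q →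
    c ≠ [] → ∀ m, d ∣ m → ∃ c', M.evalFrom q c' = q ∧ c'.length = m := by
  have hex : ∀ q, ∃ g : ℕ, 0 < g ∧ ∀ c, M.evalFrom q c = q → c ≠ [] →
      ∃ c', M.evalFrom q c' = q ∧ c'.length = g := by
    intro q
    by_cases h : ∃ c, M.evalFrom q c = q ∧ c ≠ []
    · obtain ⟨c, hc, hne⟩ := h
      exact ⟨c.length, List.length_pos_iff.mpr hne, fun _ _ _ => ⟨c, hc, rfl⟩⟩
    · exact ⟨1, one_pos, fun c hc hne => absurd ⟨c, hc, hne⟩ h⟩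
  choose g hg hloop using hex
  refine ⟨∏ q, g q, Finset.prod_pos fun q _ => hg q, fun q c hc hne m hm => ?_⟩
  obtain ⟨c', hc', hlen⟩ := hloop q c hc hne
  obtain ⟨j, rfl⟩ := (Finset.dvd_prod_of_mem g (Finset.mem_univ q)).trans hm
  refine ⟨(List.replicate j ()).flatMap fun _ => c', evalFrom_flatMap_eq (fun _ => hc') _, ?_⟩
  rw [length_flatMap_eq (fun _ => hlen), List.length_replicate, mul_comm]

/-- If `w` and `w'` have the same state-residue pairs at suffixes, their final states reach each
other, and the connecting word can be compared with a loop of its own length. -/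
theorem mem_closure_leftIdeal_of_length_determined (hM : M.accepts = L.reverse)
    (hwb : ∀ x u u' v v', u.length = v.length → M.evalFrom (M.eval x) (u ++ u') = M.eval x →
      M.evalFrom (M.eval x) (v ++ v') = M.eval x → M.evalFrom (M.eval x) u ∈ M.accept →
      M.evalFrom (M.eval x) v ∈ M.accept) :
    L ∈ BooleanSubalgebra.closure (regularLeftIdeal α ∪ regularLength α) := by
  obtain ⟨d, hd, hloop⟩ := exists_common_loop_length M
  have : NeZero d := ⟨hd.ne'⟩
  let K : σ × ZMod d → Language α := fun p =>
    {w | M.eval w.reverse = p.1} ⊓ {w | (w.length : ZMod d) = p.2}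
  have hK : ∀ p, (K p).IsRegular := by
    intro p
    refine Language.IsRegular.inf (Language.IsRegular.of_reverse ?_) (isRegular_length_mod d p.2)
    let P : DFA α σ := { M with accept := {p.1} }
    refine ⟨σ, inferInstance, P, ?_⟩
    ext w
    change M.eval w = p.1 ↔ M.eval w.reverse.reverse = p.1
    rw [List.reverse_reverse]
  let S : (σ × ZMod d) ⊕ ZMod d → Language α :=
    Sum.elim (fun p => ⊤ * K p) fun r => {w | (w.length : ZMod d) = r}
  refine mem_booleanSubalgebra_of_separating S ?_ ?_
  · rintro (p | r)
    · exact BooleanSubalgebra.subset_closure (Or.inl ⟨K p, hK p, rfl⟩)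
    · exact BooleanSubalgebra.subset_closure (Or.inr (length_mod_mem_regularLength d r))
  · intro w w' h hw
    have hself : ∀ w, w ∈ ⊤ * K (M.eval w.reverse, (w.length : ZMod d)) := fun w =>
      Language.mem_mul.mpr ⟨[], trivial, w, ⟨rfl, rfl⟩, rfl⟩
    have hlen : (w.length : ZMod d) = w'.length := ((h (Sum.inr _)).mp rfl).symm
    obtain ⟨a', -, b', ⟨hb', hbl'⟩, rfl⟩ := Language.mem_mul.mp ((h (Sum.inl _)).mp (hself w))
    obtain ⟨a, -, b, ⟨hb, -⟩, hab⟩ := Language.mem_mul.mp ((h (Sum.inl _)).mpr (hself (a' ++ b')))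
    change M.eval b'.reverse = M.eval w.reverse at hb'
    change (b'.length : ZMod d) = w.length at hbl'
    change M.eval b.reverse = M.eval (a' ++ b').reverse at hb
    have h1 : M.eval (a' ++ b').reverse = M.evalFrom (M.eval w.reverse) a'.reverse := by
      rw [eval_reverse_append, hb']
    have h2 : M.eval w.reverse = M.evalFrom (M.eval (a' ++ b').reverse) a.reverse := by
      rw [← hab, eval_reverse_append, hb]
    rw [mem_iff_eval_reverse hM] at hw ⊢
    rcases eq_or_ne a' [] with rfl | hne
    · rwa [h1]
    · have hcyc : M.evalFrom (M.eval w.reverse) (a'.reverse ++ a.reverse) = M.eval w.reverse := by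
        rw [DFA.evalFrom_of_append, ← h1, ← h2]
      -- The suffix `b'` and the whole of `w'` both have length congruent to that of `w`.
      have hdvd : d ∣ a'.length := by
        rw [← ZMod.natCast_eq_zero_iff]
        rw [List.length_append, Nat.cast_add, hbl'] at hlen
        simpa using hlen
      obtain ⟨c, hc, hcl⟩ := hloop _ _ hcyc (by simp [hne]) _ hdvd
      rw [h1]
      -- The loop `c` ends in the accepting state of `w`, so the equally long `a'.reverse` must
      -- accept too.
      exact hwb w.reverse c [] a'.reverse a.reverse (by simp [hcl]) (by simpa using hc) hcyc
        (by rwa [hc])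

/-- The last `k` symbols fix a state, and from there acceptance on any word equals acceptance on a
power of `pad` of the same length. -/
theorem mem_closure_suffixTestable_of_length_determined [Finite α] (pad : α)
    (hM : M.accepts = L.reverse) (k : ℕ)
    (hgood : ∀ x : List α, x.length = k → ∀ y z : List α, y.length = z.length →
      M.evalFrom (M.eval x) y ∈ M.accept → M.evalFrom (M.eval x) z ∈ M.accept) :
    L ∈ BooleanSubalgebra.closure (suffixTestable α ∪ regularLength α) := by
  have : Finite {v : List α // v.length ≤ k} := List.finite_length_le α k
  let S : {v : List α // v.length ≤ k} ⊕ σ → Language α :=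
    Sum.elim (fun v => ⊤ * {v.1})
      fun q => {w | M.evalFrom q (List.replicate (w.length - k) pad) ∈ M.accept}
  refine mem_booleanSubalgebra_of_separating S ?_ ?_
  · rintro (v | q)
    · exact BooleanSubalgebra.subset_closure
        (Or.inl (BooleanSubalgebra.subset_closure ⟨v.1, rfl⟩))
    · exact BooleanSubalgebra.subset_closure (Or.inr (unary_mem_regularLength M q pad k))
  · intro w w' h hw
    have hsuf : ∀ v : List α, v.length ≤ k →
        ((∃ a, a ++ v = w) ↔ ∃ a, a ++ v = w') := by
      intro v hv
      have hmem : ∀ w : List α, w ∈ (⊤ * {v} : Language α) ↔ ∃ a, a ++ v = w := by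
        intro w
        rw [Language.mem_mul]
        constructor
        · rintro ⟨a, -, b, rfl, hab⟩
          exact ⟨a, hab⟩
        · rintro ⟨a, ha⟩
          exact ⟨a, trivial, v, rfl, ha⟩
      rw [← hmem, ← hmem]
      exact h (Sum.inl ⟨v, hv⟩)
    by_cases hlong : ∃ v a a' : List α, v.length = k ∧ a ++ v = w ∧ a' ++ v = w'
    · obtain ⟨v, a, a', hv, rfl, rfl⟩ := hlong
      have hq := h (Sum.inr (M.eval v.reverse))
      change M.evalFrom _ (List.replicate ((a ++ v).length - k) pad) ∈ M.accept ↔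
        M.evalFrom _ (List.replicate ((a' ++ v).length - k) pad) ∈ M.accept at hq
      rw [List.length_append, List.length_append, hv, Nat.add_sub_cancel,
        Nat.add_sub_cancel] at hq
      have hvr : v.reverse.length = k := by simp [hv]
      rw [mem_iff_eval_reverse hM, eval_reverse_append] at hw ⊢
      exact hgood _ hvr _ _ (by simp) (hq.mp (hgood _ hvr _ _ (by simp) hw))
    · have hsplit : ∀ w : List α, k ≤ w.length →
          ∃ v a : List α, v.length = k ∧ a ++ v = w := fun w hk =>
        ⟨w.drop (w.length - k), w.take (w.length - k), by
          rw [List.length_drop, Nat.sub_sub_self hk], List.take_append_drop _ _⟩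
      have hk : w.length < k := by
        by_contra hcon
        obtain ⟨v, a, hv, ha⟩ := hsplit w (not_lt.mp hcon)
        obtain ⟨a', ha'⟩ := (hsuf v hv.le).mp ⟨a, ha⟩
        exact hlong ⟨v, a, a', hv, ha, ha'⟩
      have hk' : w'.length < k := by
        by_contra hcon
        obtain ⟨v, a', hv, ha'⟩ := hsplit w' (not_lt.mp hcon)
        obtain ⟨a, ha⟩ := (hsuf v hv.le).mpr ⟨a', ha'⟩
        exact hlong ⟨v, a, a', hv, ha, ha'⟩
      -- Two short words with the same short suffixes are suffixes of each other, hence equal.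
      obtain ⟨a, ha⟩ := (hsuf w hk.le).mp ⟨[], rfl⟩
      obtain ⟨a', ha'⟩ := (hsuf w' hk'.le).mpr ⟨[], rfl⟩
      have hl := congrArg List.length ha
      have hl' := congrArg List.length ha'
      rw [List.length_append] at hl hl'
      have hnil : a = [] := List.length_eq_zero_iff.mp (by omega)
      rw [hnil, List.nil_append] at ha
      exact ha ▸ hw

end Classification

/-! ### Many quotients outside the classes -/

section Dichotomies

variable {α : Type u} {L : Language α}

theorem exists_exponential_quotients (pad : α) (hL : L.IsRegular)
    (hnot : L ∉ BooleanSubalgebra.closure (regularLeftIdeal α ∪ regularLength α)) :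
    ∃ a b : ℕ, 0 < b ∧ ∀ N : ℕ, ((2 ^ N : ℕ) : ℕ∞) ≤
      (Set.range (SWn pad L (a + N * b)).leftQuotient).encard := by
  obtain ⟨σ, _, M, hM⟩ := hL.reverse
  have hbad := mt (mem_closure_leftIdeal_of_length_determined hM) hnot
  push Not at hbad
  obtain ⟨x, u, u', v, v', hlen, hu, hv, hua, hva⟩ := hbad
  have hpos : 0 < u.length := by
    rw [List.length_pos_iff]
    rintro rfl
    rw [List.length_nil, eq_comm, List.length_eq_zero_iff] at hlen
    exact hva (hlen ▸ hua)
  refine ⟨x.length + u.length, (u ++ u' ++ (v ++ v')).length, by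
    simp only [List.length_append]; omega, fun N => ?_⟩
  have h := two_pow_le_quotients (pad := pad) hM rfl hlen hu hv hua hva N
  rwa [add_right_comm] at h

theorem exists_linear_quotients [Finite α] (pad : α) (hL : L.IsRegular)
    (hnot : L ∉ BooleanSubalgebra.closure (suffixTestable α ∪ regularLength α)) :
    ∃ a b : ℕ, 0 < b ∧ ∀ N : ℕ, ((N + 1 : ℕ) : ℕ∞) ≤
      (Set.range (SWn pad L (a + N * b)).leftQuotient).encard := by
  obtain ⟨σ, _, M, hM⟩ := hL.reverse
  have hbad := mt (mem_closure_suffixTestable_of_length_determined pad hM (Fintype.card σ)) hnot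
  push Not at hbad
  obtain ⟨x, hx, y, z, hlen, hy, hz⟩ := hbad
  -- By pigeonhole, a path of `|σ|` letters contains a nonempty loop `c` at some `q`; the rest `r`
  -- is absorbed into the two distinguishing words.
  obtain ⟨q, s, c, r, -, -, hc, hs, hcq, hr⟩ := M.evalFrom_split (s := M.start) hx.ge rfl
  have hlen' : (r ++ y).length = (r ++ z).length := by simp [hlen]
  have hy' : M.evalFrom q (r ++ y) ∈ M.accept := by
    rw [DFA.evalFrom_of_append, hr]; exact hy
  have hz' : M.evalFrom q (r ++ z) ∉ M.accept := by
    rw [DFA.evalFrom_of_append, hr]; exact hz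
  have hpos : 0 < (r ++ y).length := by
    rw [List.length_pos_iff]
    intro h
    rw [h, List.length_nil, eq_comm, List.length_eq_zero_iff] at hlen'
    rw [h] at hy'
    rw [hlen'] at hz'
    exact hz' hy'
  -- Repeat `c` until the loop is at least as long as the test words. One of these must then
  -- disagree with the prefix of `p` of the same length.
  let p : List α := (List.replicate (r ++ y).length ()).flatMap fun _ => c
  have hpq : M.evalFrom q p = q := evalFrom_flatMap_eq (fun _ => hcq) _
  have hpl : (r ++ y).length ≤ p.length := by
    rw [length_flatMap_eq (fun _ => rfl), List.length_replicate]
    exact Nat.le_mul_of_pos_right _ (List.length_pos_iff.mpr hc)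
  have key : ∀ t : List α, t.length = (r ++ y).length →
      ¬(M.evalFrom q t ∈ M.accept ↔ M.evalFrom q (p.take (r ++ y).length) ∈ M.accept) →
      ∃ a b : ℕ, 0 < b ∧ ∀ N : ℕ, ((N + 1 : ℕ) : ℕ∞) ≤
        (Set.range (SWn pad L (a + N * b)).leftQuotient).encard := by
    intro t ht hta
    refine ⟨s.length + t.length, p.length, hpos.trans_le hpl, fun N => ?_⟩
    rw [← ht] at hta
    have h := succ_le_quotients (pad := pad) hM hs hpq (ht.le.trans hpl) hta N
    rwa [add_right_comm] at h
  by_cases hp : M.evalFrom q (p.take (r ++ y).length) ∈ M.accept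
  · exact key (r ++ z) hlen'.symm fun h => hz' (h.mpr hp)
  · exact key (r ++ y) rfl fun h => hp (h.mp hy')

end Dichotomies

/-! ### Growth rates -/

section Growth

theorem isLittleO_one_logb :
    (fun _ : ℕ => (1 : ℝ)) =o[atTop] fun n : ℕ => Real.logb 2 n := by
  rw [isLittleO_const_left]
  right
  exact tendsto_norm_atTop_atTop.comp
    ((Real.tendsto_logb_atTop (by norm_num)).comp tendsto_natCast_atTop_atTop)

theorem isLittleO_logb_natCast :
    (fun n : ℕ => Real.logb 2 n) =o[atTop] fun n : ℕ => (n : ℝ) := by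
  have h := (Real.isLittleO_log_id_atTop.comp_tendsto tendsto_natCast_atTop_atTop).const_mul_left
    (Real.log 2)⁻¹ (l := (atTop : Filter ℕ))
  refine h.congr_left fun n => ?_
  simp only [Function.comp_apply, Real.logb]
  rw [mul_comm, div_eq_mul_inv]

theorem eventually_logb_pos : ∀ᶠ n : ℕ in atTop, 0 < Real.logb 2 (n : ℝ) := by
  filter_upwards [eventually_ge_atTop 2] with n hn
  exact Real.logb_pos (by norm_num) (by exact_mod_cast hn)

theorem IsBarOmega.not_isBigO {f g h : ℕ → ℝ} (hf : IsBarOmega f g)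
    (hg : ∀ᶠ n in atTop, 0 < g n) (hhg : h =o[atTop] g) : ¬f =O[atTop] h := by
  intro hfh
  obtain ⟨c, hc, hinf⟩ := hf
  obtain ⟨n, hn, hcn, hgn⟩ := ((Nat.frequently_atTop_iff_infinite.mpr hinf).and_eventually
    (((hfh.trans_isLittleO hhg).bound (half_pos hc)).and hg)).exists
  rw [Real.norm_of_nonneg hgn.le] at hcn
  have h1 := (le_abs_self (f n)).trans hcn
  have h2 : 0 < c * g n := mul_pos hc hgn
  have h3 : c * g n ≤ f n := hn
  linarith

theorem isBarOmega_of_isBigO {f g : ℕ → ℝ} (hf : ∀ n, 0 ≤ f n) (hg : ∀ᶠ n in atTop, 0 < g n)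
    (h : g =O[atTop] f) : IsBarOmega f g := by
  obtain ⟨c, hc, hb⟩ := h.exists_pos
  refine ⟨c⁻¹, inv_pos.mpr hc, Nat.frequently_atTop_iff_infinite.mp (Eventually.frequently ?_)⟩
  filter_upwards [hb.bound, hg] with n hn hgn
  rw [Real.norm_of_nonneg hgn.le, Real.norm_of_nonneg (hf n)] at hn
  rwa [inv_mul_le_iff₀ hc]

theorem logb_two_pow (N : ℕ) : Real.logb 2 ((2 ^ N : ℕ) : ℝ) = N := by
  rw [Nat.cast_pow, Nat.cast_ofNat, Real.logb_pow, Real.logb_self_eq_one (by norm_num), mul_one]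

theorem isBarOmega_linear {f : ℕ → ℝ} {a b : ℕ} (hb : 0 < b)
    (h : ∀ N : ℕ, (N : ℝ) ≤ f (a + N * b)) : IsBarOmega f fun n => (n : ℝ) := by
  have hab : (0 : ℝ) < a + b := by positivity
  refine ⟨(a + b : ℝ)⁻¹, inv_pos.mpr hab, ?_⟩
  refine Set.infinite_of_injective_forall_mem (f := fun N : ℕ => a + (N + 1) * b) ?_ fun N => ?_
  · intro N N' hN
    have := Nat.eq_of_mul_eq_mul_right hb (Nat.add_left_cancel hN)
    omega
  · refine le_trans ?_ (h (N + 1))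
    rw [inv_mul_le_iff₀ hab]
    push_cast
    have h1 : (0 : ℝ) ≤ (N : ℝ) * a := by positivity
    nlinarith

theorem isBarOmega_logb {f : ℕ → ℝ} {a b : ℕ} (hb : 0 < b)
    (h : ∀ N : ℕ, Real.logb 2 ((N + 1 : ℕ) : ℝ) ≤ f (a + N * b)) :
    IsBarOmega f fun n => Real.logb 2 n := by
  -- With `m = N + a + b`, the window size `a + m * b` is at most `(m + 1) ^ 2`; the square costs
  -- the factor `1 / 2`.
  refine ⟨1 / 2, by norm_num, ?_⟩
  refine Set.infinite_of_injective_forall_mem (f := fun N : ℕ => a + (N + a + b) * b) ?_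
    fun N => ?_
  · intro N N' hN
    have := Nat.eq_of_mul_eq_mul_right hb (Nat.add_left_cancel hN)
    omega
  · refine le_trans ?_ (h (N + a + b))
    have h1 : a + (N + a + b) * b ≤ (N + a + b + 1) ^ 2 := by nlinarith
    have h2 : 0 < a + (N + a + b) * b := by positivity
    have h3 := Real.logb_le_logb_of_le (b := 2) (by norm_num) (by exact_mod_cast h2)
      (by exact_mod_cast h1 : ((a + (N + a + b) * b : ℕ) : ℝ) ≤ ((N + a + b + 1 : ℕ) : ℝ) ^ 2)
    rw [Real.logb_pow] at h3
    push_cast at h3 ⊢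
    linarith

theorem natCast_isBigO_of_monotone {f : ℕ → ℝ} (hmono : Monotone f) {a b : ℕ} (hb : 0 < b)
    (h : ∀ N : ℕ, (N : ℝ) ≤ f (a + (N + 1) * b)) : (fun n : ℕ => (n : ℝ)) =O[atTop] f := by
  refine IsBigO.of_bound (2 * b : ℝ) ?_
  filter_upwards [eventually_ge_atTop (2 * (a + 2 * b))] with n hn
  -- Round `n` down to the progression. For `n ≥ 2 * (a + 2 * b)`, the loss of `a + 2 * b` is at
  -- most half of `n`.
  obtain ⟨N, hN⟩ : ∃ N, (n - a) / b = N + 1 := by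
    refine Nat.exists_eq_succ_of_ne_zero (Nat.div_pos ?_ hb).ne'
    omega
  have h1 : (N + 1) * b ≤ n - a := hN ▸ Nat.div_mul_le_self _ _
  have h2 : n - a < (N + 1 + 1) * b := by
    rw [← hN, mul_comm]
    exact Nat.lt_mul_div_succ _ hb
  have h3 : n ≤ 2 * b * N := by
    have : (N + 1 + 1) * b = b * N + 2 * b := by ring
    have : 2 * b * N = 2 * (b * N) := by ring
    omega
  have h4 : (N : ℝ) ≤ f n := (h N).trans (hmono (by omega))
  rw [Real.norm_of_nonneg (Nat.cast_nonneg n)]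
  calc (n : ℝ) ≤ 2 * b * N := by exact_mod_cast h3
    _ ≤ 2 * b * f n := by gcongr
    _ ≤ 2 * b * ‖f n‖ := by gcongr; exact Real.le_norm_self _

end Growth

/-! ### From quotient counts to asymptotics -/

section SpaceGrowth

variable {α : Type u} {L : Language α}

theorem HasBoundedQuotients.isBigO {pad : α} (h : HasBoundedQuotients pad L) :
    fixedSpace pad L =O[atTop] fun _ => (1 : ℝ) := by
  obtain ⟨C, hC⟩ := h
  refine IsBigO.of_bound (Real.logb 2 C) (Eventually.of_forall fun n => ?_)
  rw [Real.norm_of_nonneg (fixedSpace_nonneg pad L n), norm_one, mul_one]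
  exact fixedSpace_le (hC n)

theorem HasPolyQuotients.isBigO (h : HasPolyQuotients L) :
    varSpace L =O[atTop] fun n : ℕ => Real.logb 2 n := by
  obtain ⟨C, hC⟩ := h
  refine IsBigO.of_bound (C * 2 : ℝ) ?_
  filter_upwards [eventually_ge_atTop 2] with n hn
  rw [Real.norm_of_nonneg (varSpace_nonneg L n), Real.norm_of_nonneg (logb_natCast_nonneg n)]
  refine (varSpace_le (hC n)).trans ?_
  have h1 : n + 2 ≤ n ^ 2 := by nlinarith
  have h2 := Real.logb_le_logb_of_le (b := 2) (by norm_num) (by positivity)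
    (by exact_mod_cast h1 : ((n + 2 : ℕ) : ℝ) ≤ (n : ℝ) ^ 2)
  rw [Real.logb_pow] at h2
  rw [Nat.cast_pow, Real.logb_pow, mul_assoc]
  push_cast at h2 ⊢
  gcongr

theorem varSpace_isBigO_natCast [Finite α] (L : Language α) :
    varSpace L =O[atTop] fun n : ℕ => (n : ℝ) := by
  refine IsBigO.of_bound (Real.logb 2 (Nat.card α + 1)) (Eventually.of_forall fun n => ?_)
  rw [Real.norm_of_nonneg (varSpace_nonneg L n), Real.norm_of_nonneg (Nat.cast_nonneg n)]
  exact varSpace_le_linear L n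

theorem fixedSpace_isBigO_varSpace [Finite α] (pad : α) (L : Language α) :
    fixedSpace pad L =O[atTop] varSpace L := by
  refine IsBigO.of_bound 1 ?_
  filter_upwards [eventually_gt_atTop 0] with n hn
  rw [Real.norm_of_nonneg (fixedSpace_nonneg pad L n), Real.norm_of_nonneg (varSpace_nonneg L n),
    one_mul]
  exact fixedSpace_le_varSpace pad L hn

theorem logb_isBigO_varSpace [Finite α] (h0 : L ≠ ⊥) (h1 : L ≠ ⊤) :
    (fun n : ℕ => Real.logb 2 n) =O[atTop] varSpace L := by
  refine IsBigO.of_bound 1 ?_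
  filter_upwards [eventually_gt_atTop 0] with n hn
  rw [Real.norm_of_nonneg (varSpace_nonneg L n), Real.norm_of_nonneg (logb_natCast_nonneg n),
    one_mul]
  refine le_trans ?_ (le_varSpace (succ_le_var_quotients h0 h1 n))
  exact Real.logb_le_logb_of_le (by norm_num) (by exact_mod_cast hn)
    (by exact_mod_cast Nat.le_succ n)

theorem varSpace_isBigO_one_of_trivial (h : L = ⊥ ∨ L = ⊤) :
    varSpace L =O[atTop] fun _ => (1 : ℝ) := by
  refine IsBigO.of_bound 0 (Eventually.of_forall fun n => ?_)
  have hle : varSpace L n ≤ Real.logb 2 ((1 : ℕ) : ℝ) := by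
    refine varSpace_le ?_
    rw [Nat.cast_one, Set.encard_le_one_iff]
    rintro _ _ ⟨x, -, rfl⟩ ⟨y, -, rfl⟩
    rcases h with rfl | rfl <;> rfl
  rw [Nat.cast_one, Real.logb_one] at hle
  rw [Real.norm_of_nonneg (varSpace_nonneg L n), zero_mul]
  exact hle

theorem fixedSpace_isBarOmega_logb [Finite α] (pad : α) (hL : L.IsRegular)
    (hnot : L ∉ BooleanSubalgebra.closure (suffixTestable α ∪ regularLength α)) :
    IsBarOmega (fixedSpace pad L) fun n => Real.logb 2 n := by
  obtain ⟨a, b, hb, h⟩ := exists_linear_quotients pad hL hnot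
  exact isBarOmega_logb hb fun N => le_fixedSpace (h N)

theorem fixedSpace_isBarOmega_natCast [Finite α] (pad : α) (hL : L.IsRegular)
    (hnot : L ∉ BooleanSubalgebra.closure (regularLeftIdeal α ∪ regularLength α)) :
    IsBarOmega (fixedSpace pad L) fun n => (n : ℝ) := by
  obtain ⟨a, b, hb, h⟩ := exists_exponential_quotients pad hL hnot
  exact isBarOmega_linear hb fun N => (logb_two_pow N).ge.trans (le_fixedSpace (h N))

theorem natCast_isBigO_varSpace [Finite α] (pad : α) (hL : L.IsRegular)
    (hnot : L ∉ BooleanSubalgebra.closure (regularLeftIdeal α ∪ regularLength α)) :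
    (fun n : ℕ => (n : ℝ)) =O[atTop] varSpace L := by
  obtain ⟨a, b, hb, h⟩ := exists_exponential_quotients pad hL hnot
  -- Using `N + 1` blocks keeps the window size positive, as the comparison of the two models
  -- requires.
  refine natCast_isBigO_of_monotone (varSpace_mono L) (a := a) hb fun N => ?_
  have hN : (N : ℝ) ≤ Real.logb 2 ((2 ^ (N + 1) : ℕ) : ℝ) := by
    rw [logb_two_pow]
    exact_mod_cast Nat.le_succ N
  exact hN.trans ((le_fixedSpace (h (N + 1))).trans
    (fixedSpace_le_varSpace pad L (by positivity)))

end SpaceGrowth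

end SlidingWindow

/-! ### The trichotomies -/

theorem mainTheorem1 {α : Type*} [Finite α] (pad : α) (L : Language α) (hL : L.IsRegular) :
    -- fixed-size model
    ((SlidingWindow.fixedSpace pad L =O[atTop] (fun _ => (1 : ℝ))) ∨
      SlidingWindow.IsBarTheta (SlidingWindow.fixedSpace pad L) (fun n => Real.logb 2 n) ∨
      SlidingWindow.IsBarTheta (SlidingWindow.fixedSpace pad L) (fun n => (n : ℝ))) ∧
    ((SlidingWindow.fixedSpace pad L =O[atTop] (fun _ => (1 : ℝ))) ↔
      L ∈ BooleanSubalgebra.closure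
        (SlidingWindow.suffixTestable α ∪ SlidingWindow.regularLength α)) ∧
    ((SlidingWindow.fixedSpace pad L =O[atTop] (fun n : ℕ => Real.logb 2 n)) ↔
      L ∈ BooleanSubalgebra.closure
        (SlidingWindow.regularLeftIdeal α ∪ SlidingWindow.regularLength α)) ∧
    -- variable-size model
    ((SlidingWindow.varSpace L =O[atTop] (fun _ => (1 : ℝ))) ∨
      (SlidingWindow.varSpace L =Θ[atTop] (fun n : ℕ => Real.logb 2 n)) ∨
      (SlidingWindow.varSpace L =Θ[atTop] (fun n : ℕ => (n : ℝ)))) ∧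
    ((SlidingWindow.varSpace L =O[atTop] (fun _ => (1 : ℝ))) ↔ (L = ⊥ ∨ L = ⊤)) ∧
    ((SlidingWindow.varSpace L =O[atTop] (fun n : ℕ => Real.logb 2 n)) ↔
      L ∈ BooleanSubalgebra.closure
        (SlidingWindow.regularLeftIdeal α ∪ SlidingWindow.regularLength α)) := by
  open SlidingWindow in
  have hFV := fixedSpace_isBigO_varSpace pad L
  have hV : L ∈ BooleanSubalgebra.closure (regularLeftIdeal α ∪ regularLength α) →
      varSpace L =O[atTop] fun n : ℕ => Real.logb 2 n := fun h =>
    (hasPolyQuotients_of_mem_closure h).isBigO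
  have hpos : ∀ᶠ n : ℕ in atTop, (0 : ℝ) < n := by
    filter_upwards [eventually_gt_atTop 0] with n hn
    exact_mod_cast hn
  refine ⟨?_, ⟨fun h => ?_, fun h => (hasBoundedQuotients_of_mem_closure h).isBigO⟩,
    ⟨fun h => ?_, fun h => hFV.trans (hV h)⟩, ?_,
    ⟨fun h => ?_, varSpace_isBigO_one_of_trivial⟩, ⟨fun h => ?_, hV⟩⟩
  · by_cases h1 : L ∈ BooleanSubalgebra.closure (suffixTestable α ∪ regularLength α)
    · exact Or.inl (hasBoundedQuotients_of_mem_closure h1).isBigO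
    by_cases h2 : L ∈ BooleanSubalgebra.closure (regularLeftIdeal α ∪ regularLength α)
    · exact Or.inr (Or.inl ⟨hFV.trans (hV h2), fixedSpace_isBarOmega_logb pad hL h1⟩)
    · exact Or.inr (Or.inr ⟨hFV.trans (varSpace_isBigO_natCast L),
        fixedSpace_isBarOmega_natCast pad hL h2⟩)
  · by_contra hcon
    exact (fixedSpace_isBarOmega_logb pad hL hcon).not_isBigO eventually_logb_pos
      isLittleO_one_logb h
  · by_contra hcon
    exact (fixedSpace_isBarOmega_natCast pad hL hcon).not_isBigO hpos isLittleO_logb_natCast h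
  · by_cases h1 : L = ⊥ ∨ L = ⊤
    · exact Or.inl (varSpace_isBigO_one_of_trivial h1)
    by_cases h2 : L ∈ BooleanSubalgebra.closure (regularLeftIdeal α ∪ regularLength α)
    · exact Or.inr (Or.inl ⟨hV h2, logb_isBigO_varSpace (fun h => h1 (Or.inl h))
        fun h => h1 (Or.inr h)⟩)
    · exact Or.inr (Or.inr ⟨varSpace_isBigO_natCast L, natCast_isBigO_varSpace pad hL h2⟩)
  · by_contra hcon
    exact (isBarOmega_of_isBigO (varSpace_nonneg L) eventually_logb_pos
      (logb_isBigO_varSpace (fun h => hcon (Or.inl h)) fun h => hcon (Or.inr h))).not_isBigO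
      eventually_logb_pos isLittleO_one_logb h
  · by_contra hcon
    exact (isBarOmega_of_isBigO (varSpace_nonneg L) hpos
      (natCast_isBigO_varSpace pad hL hcon)).not_isBigO hpos isLittleO_logb_natCast h
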